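/- Throughout, $*$-homomorphisms are not required to be unital. A \emph{reflection} on a C*-algebra $A$ is a linear, $*$-preserving, antimultiplicative map $a\mapsto a^{\tau}$ with $(a^{\tau})^{\tau}=a$; a $*$-$\tau$-homomorphism is a $*$-homomorphism that intertwines the given reflections. A reflection on a compact Hausdorff space $X$ is a homeomorphism $\tau$ of $X$ with $\tau\circ\tau=\mathrm{id}$; it gives the reflection $f^{\tau}=f\circ\tau$ on $C(X)$, and $C(X,\tau)$ denotes $C(X)$ with this reflection. For a sequence $(d_k)$ of natural numbers, $\prod M_{d_k}$ is the C*-algebra of sequences of complex matrices $a_k\in M_{d_k}(\mathbb C)$ that are bounded in operator norm, $\bigoplus M_{d_k}$ is the ideal of the sequences with $\|a_k\|\to 0$, and $\tau_0$ is either the transpose, or, if all $d_k$ are even, the dual operation $$\begin{pmatrix}A&B\\ C&D\end{pmatrix}^{\sharp}=\begin{pmatrix}D^{T}&-B^{T}\\ -C^{T}&A^{T}\end{pmatrix}.$$ Applied termwise, $\tau_0$ gives a reflection on $\prod M_{d_k}$ and on the matrix corona $\prod M_{d_k}/\bigoplus M_{d_k}$. \textbf{Theorem.} Let $X$ be a compact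 (that is, finite) CW complex of dimension at most $1$, let $\tau$ be a reflection on $X$, and let $x_1,\dots,x_n,y_1,\dots,y_n$ be $2n$ distinct points in the interiors of $1$-cells of $X$ with $\tau(x_i)=y_i$ for $1\le i\le n$. Let $X^{[2n]}$ be $X$ with gaps opened up at these $2n$ points: each of the points is removed and replaced by two points, one endpoint for each of the two arcs of its $1$-cell that lead to it. Let $q\colon X^{[2n]}\to X$ be the continuous map that collapses each gap to a point (the two new endpoints at $p$ go to $p$, all other points are fixed), and let $\alpha^{[2n]}\colon C(X)\to C(X^{[2n]})$, $f\mapsto f\circ q$. Then $X^{[2n]}$ is a compact Hausdorff space, there is exactly one homeomorphism $\sigma$ of $X^{[2n]}$ with $q\circ\sigma=\tau\circ q$, this $\sigma$ is a reflection (again denoted $\tau$), and $\alpha^{[2n]}\colon C(X,\tau)\to C(X^{[2n]},\tau)$ is a $*$-$\tau$-homomorphism. Moreover, for every sequence $(d_k)$ of natural numbers (all even, if $\tau_0$ is the dual operation) and every $*$-$\tau$-homomorphism $$\phi\colon C(X,\tau)\to \prod (M_{d_k},\tau_0)\Big/\bigoplus (M_{d_k},\tau_0)$$ there exists a $*$-$\tau$-homomorphism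 $$\psi\colon C(X^{[2n]},\tau)\to \prod (M_{d_k},\tau_0)\Big/\bigoplus (M_{d_k},\tau_0)$$ such that $\psi\circ\alpha^{[2n]}=\phi$. -/

import Mathlib

noncomputable section

namespace TauAlg

open Topology Filter Set Matrix
open scoped Matrix.Norms.L2Operator

/-! ### Reflections on `*`-algebras and `*`-`τ`-homomorphisms -/

/-- A reflection (a `τ`-operation) on a complex `*`-algebra: a linear, `*`-preserving,
antimultiplicative map `a ↦ a^τ` with `(a^τ)^τ = a`. A C*-algebra with such a map is a
C*,τ-algebra. -/
structure Reflection (A : Type*) [Ring A] [StarRing A] [Algebra ℂ A] where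
  toLinearMap : A →ₗ[ℂ] A
  map_mul : ∀ a b, toLinearMap (a * b) = toLinearMap b * toLinearMap a
  map_star : ∀ a, toLinearMap (star a) = star (toLinearMap a)
  involutive : ∀ a, toLinearMap (toLinearMap a) = a

instance {A : Type*} [Ring A] [StarRing A] [Algebra ℂ A] :
    CoeFun (Reflection A) (fun _ => A → A) :=
  ⟨fun τ => τ.toLinearMap⟩

/-- A `*`-homomorphism (not necessarily unital) is a `*`-`τ`-homomorphism if it intertwines the
reflections. -/
def IsTauHom {A B : Type*} [Ring A] [StarRing A] [Algebra ℂ A] [Ring B] [StarRing B] [Algebra ℂ B]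
    (τA : Reflection A) (τB : Reflection B) (φ : A →⋆ₙₐ[ℂ] B) : Prop :=
  ∀ a, φ (τA a) = τB (φ a)

/-- The reflection `f ↦ f ∘ τ` on `C(X)` given by an involutive homeomorphism `τ` of `X`. -/
def functionReflection {X : Type*} [TopologicalSpace X] (τ : X ≃ₜ X)
    (hτ : Function.Involutive τ) : Reflection C(X, ℂ) where
  toLinearMap :=
    { toFun := fun f => f.comp (τ : C(X, X))
      map_add' := fun _ _ => rfl
      map_smul' := fun _ _ => rfl }
  map_mul a b := by
    ext x
    exact mul_comm _ _
  map_star _ := rfl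
  involutive f := by
    ext x
    exact congrArg f (hτ x)

/-- A reflection on a C*-algebra is isometric. -/
theorem Reflection.norm_apply {A : Type*} [CStarAlgebra A] (τ : Reflection A) (a : A) :
    ‖τ a‖ = ‖a‖ := by
  let g : A →⋆ₙₐ[ℂ] Aᵐᵒᵖ :=
    { toFun := fun a => MulOpposite.op (τ a)
      map_smul' := fun c a => by simp
      map_zero' := by simp
      map_add' := fun a b => by simp
      map_mul' := fun a b => by simp [τ.map_mul]
      map_star' := fun a => by simp [τ.map_star] }
  have hg : Function.Injective g := by
    intro a b h
    have h1 : τ a = τ b := MulOpposite.op_injective h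
    rw [← τ.involutive a, ← τ.involutive b]
    exact congrArg _ h1
  exact NonUnitalStarAlgHom.norm_map g hg a

/-- The transpose, as a reflection on a full matrix algebra. -/
def transposeReflection (ι : Type*) [Fintype ι] [DecidableEq ι] :
    Reflection (Matrix ι ι ℂ) where
  toLinearMap :=
    { toFun := fun a => aᵀ
      map_add' := fun a b => Matrix.transpose_add a b
      map_smul' := fun c a => Matrix.transpose_smul c a }
  map_mul a b := Matrix.transpose_mul a b
  map_star a := by
    ext i j
    rfl
  involutive a := Matrix.transpose_transpose a

/-- The dual operation `[A B; C D]^♯ = [Dᵀ -Bᵀ; -Cᵀ Aᵀ]` on matrices of even size. -/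
def sharp {m : Type*} (a : Matrix (m ⊕ m) (m ⊕ m) ℂ) : Matrix (m ⊕ m) (m ⊕ m) ℂ :=
  Matrix.fromBlocks (a.toBlocks₂₂)ᵀ (-(a.toBlocks₁₂)ᵀ) (-(a.toBlocks₂₁)ᵀ) (a.toBlocks₁₁)ᵀ

theorem sharp_fromBlocks {m : Type*} (A B C D : Matrix m m ℂ) :
    sharp (Matrix.fromBlocks A B C D) = Matrix.fromBlocks Dᵀ (-Bᵀ) (-Cᵀ) Aᵀ := rfl

/-- The dual operation, as a reflection on `M_{2m}(ℂ)`. -/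
def sharpReflection (m : Type*) [Fintype m] [DecidableEq m] :
    Reflection (Matrix (m ⊕ m) (m ⊕ m) ℂ) where
  toLinearMap :=
    { toFun := sharp
      map_add' := fun a b => by
        ext (i | i) (j | j) <;> simp [sharp, toBlocks₁₁, toBlocks₁₂, toBlocks₂₁, toBlocks₂₂] <;> ring
      map_smul' := fun c a => by
        ext (i | i) (j | j) <;> simp [sharp, toBlocks₁₁, toBlocks₁₂, toBlocks₂₁, toBlocks₂₂] }
  map_mul a b := by
    rw [← Matrix.fromBlocks_toBlocks a, ← Matrix.fromBlocks_toBlocks b]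
    simp only [LinearMap.coe_mk, AddHom.coe_mk, Matrix.fromBlocks_multiply, sharp_fromBlocks,
      Matrix.transpose_add, Matrix.transpose_mul, Matrix.neg_mul, Matrix.mul_neg, neg_neg, neg_add]
    congr 1 <;> abel
  map_star a := by
    ext (i | i) (j | j) <;>
      simp [sharp, toBlocks₁₁, toBlocks₁₂, toBlocks₂₁, toBlocks₂₂, Matrix.star_apply]
  involutive a := by
    ext (i | i) (j | j) <;> simp [sharp, toBlocks₁₁, toBlocks₁₂, toBlocks₂₁, toBlocks₂₂]

/-! ### The product of matrix algebras, the direct sum, and the corona -/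

section Corona

variable (ι : ℕ → Type) [∀ k, Fintype (ι k)] [∀ k, DecidableEq (ι k)]

/-- The C*-product `∏ M_{d_k}`: sequences of matrices, bounded in operator norm
(`ι k` is an index set with `d_k` elements). -/
def matProd : StarSubalgebra ℂ (∀ k, Matrix (ι k) (ι k) ℂ) where
  carrier := {a | ∃ c : ℝ, ∀ k, ‖a k‖ ≤ c}
  mul_mem' := by
    rintro a b ⟨c, hc⟩ ⟨d, hd⟩
    exact ⟨c * d, fun k => (norm_mul_le _ _).trans
      (mul_le_mul (hc k) (hd k) (norm_nonneg _) ((norm_nonneg _).trans (hc k)))⟩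
  add_mem' := by
    rintro a b ⟨c, hc⟩ ⟨d, hd⟩
    exact ⟨c + d, fun k => (norm_add_le _ _).trans (add_le_add (hc k) (hd k))⟩
  algebraMap_mem' := by
    intro z
    refine ⟨‖z‖, fun k => ?_⟩
    have h : ‖(algebraMap ℂ (∀ k, Matrix (ι k) (ι k) ℂ) z) k‖
        = ‖(Matrix.diagonal fun _ : ι k => z)‖ := rfl
    rw [h, Matrix.l2_opNorm_diagonal]
    exact (pi_norm_le_iff_of_nonneg (norm_nonneg z)).2 fun _ => le_rfl
  star_mem' := by
    rintro a ⟨c, hc⟩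
    exact ⟨c, fun k => (norm_star (a k)).le.trans (hc k)⟩

/-- The C*-direct sum `⊕ M_{d_k}`: the ideal of sequences of matrices whose operator norms tend
to zero. -/
def matSum : Ideal (matProd ι) where
  carrier := {a | Tendsto (fun k => ‖a.1 k‖) atTop (𝓝 0)}
  add_mem' := by
    intro a b ha hb
    refine squeeze_zero (fun k => norm_nonneg _) (fun k => norm_add_le (a.1 k) (b.1 k)) ?_
    simpa using Tendsto.add ha hb
  zero_mem' := by
    have h : (fun k => ‖(0 : matProd ι).1 k‖) = fun _ => (0 : ℝ) := by
      funext k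
      exact norm_zero
    change Tendsto (fun k => ‖(0 : matProd ι).1 k‖) atTop (𝓝 0)
    rw [h]
    exact tendsto_const_nhds
  smul_mem' := by
    intro a b hb
    obtain ⟨c, hc⟩ := a.2
    refine squeeze_zero (g := fun k => c * ‖b.1 k‖) (fun k => norm_nonneg _) (fun k => ?_) ?_
    · exact (norm_mul_le (a.1 k) (b.1 k)).trans
        (mul_le_mul_of_nonneg_right (hc k) (norm_nonneg _))
    · simpa using Tendsto.const_mul c hb

instance : (matSum ι).IsTwoSided where
  mul_mem_of_left := by
    intro a b ha
    obtain ⟨c, hc⟩ := b.2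
    refine squeeze_zero (g := fun k => ‖a.1 k‖ * c) (fun k => norm_nonneg _) (fun k => ?_) ?_
    · exact (norm_mul_le (a.1 k) (b.1 k)).trans
        (mul_le_mul_of_nonneg_left (hc k) (norm_nonneg _))
    · simpa using Tendsto.mul_const c ha

/-- The matrix corona `∏ M_{d_k} / ⊕ M_{d_k}`, as a `*`-algebra. -/
def matCorona : Type := matProd ι ⧸ matSum ι

instance : Ring (matCorona ι) := inferInstanceAs (Ring (matProd ι ⧸ matSum ι))

instance : Algebra ℂ (matCorona ι) := inferInstanceAs (Algebra ℂ (matProd ι ⧸ matSum ι))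

/-- The quotient map `∏ M_{d_k} → ∏ M_{d_k} / ⊕ M_{d_k}`. -/
def coronaMk : matProd ι →ₐ[ℂ] matCorona ι := Ideal.Quotient.mkₐ ℂ (matSum ι)

variable {ι}

theorem coronaMk_surjective : Function.Surjective (coronaMk ι) := Ideal.Quotient.mk_surjective

theorem coronaMk_eq_iff {a b : matProd ι} : coronaMk ι a = coronaMk ι b ↔ a - b ∈ matSum ι :=
  Ideal.Quotient.mk_eq_mk_iff_sub_mem a b

theorem star_mem_matSum {a : matProd ι} (ha : a ∈ matSum ι) : star a ∈ matSum ι := by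
  change Tendsto (fun k => ‖star (a.1 k)‖) atTop (𝓝 0)
  simp only [norm_star]
  exact ha

instance : Star (matCorona ι) where
  star := Quotient.map' star fun a b h => by
    rw [Submodule.quotientRel_def] at h ⊢
    have h2 : star a - star b = star (a - b) := Subtype.ext (star_sub a.1 b.1).symm
    rw [h2]
    exact star_mem_matSum h

theorem star_coronaMk (a : matProd ι) : star (coronaMk ι a) = coronaMk ι (star a) := rfl

instance : StarRing (matCorona ι) where
  star_involutive x := by
    obtain ⟨a, rfl⟩ := coronaMk_surjective x
    rw [star_coronaMk, star_coronaMk, star_star]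
  star_mul x y := by
    obtain ⟨a, rfl⟩ := coronaMk_surjective x
    obtain ⟨b, rfl⟩ := coronaMk_surjective y
    rw [← map_mul, star_coronaMk, star_coronaMk, star_coronaMk, star_mul, map_mul]
  star_add x y := by
    obtain ⟨a, rfl⟩ := coronaMk_surjective x
    obtain ⟨b, rfl⟩ := coronaMk_surjective y
    rw [← map_add, star_coronaMk, star_coronaMk, star_coronaMk, star_add, map_add]

/-- A sequence of reflections on the matrix algebras acts termwise on `∏ M_{d_k}`. -/
def prodReflection (τ : ∀ k, Reflection (Matrix (ι k) (ι k) ℂ)) : Reflection (matProd ι) where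
  toLinearMap :=
    { toFun := fun a => ⟨fun k => τ k (a.1 k), by
        obtain ⟨c, hc⟩ := a.2
        exact ⟨c, fun k => ((τ k).norm_apply _).le.trans (hc k)⟩⟩
      map_add' := fun a b => Subtype.ext (funext fun k => (τ k).toLinearMap.map_add _ _)
      map_smul' := fun c a => Subtype.ext (funext fun k => (τ k).toLinearMap.map_smul c (a.1 k)) }
  map_mul a b := Subtype.ext (funext fun k => (τ k).map_mul _ _)
  map_star a := Subtype.ext (funext fun k => (τ k).map_star _)
  involutive a := Subtype.ext (funext fun k => (τ k).involutive _)

theorem prodReflection_mem (τ : ∀ k, Reflection (Matrix (ι k) (ι k) ℂ)) {a : matProd ι}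
    (ha : a ∈ matSum ι) : prodReflection τ a ∈ matSum ι := by
  change Tendsto (fun k => ‖τ k (a.1 k)‖) atTop (𝓝 0)
  simp only [Reflection.norm_apply]
  exact ha

/-- The map induced on the corona by a sequence of reflections on the matrix algebras. -/
def coronaMap (τ : ∀ k, Reflection (Matrix (ι k) (ι k) ℂ)) : matCorona ι →ₗ[ℂ] matCorona ι where
  toFun := Quotient.map' (prodReflection τ) fun a b h => by
    rw [Submodule.quotientRel_def] at h ⊢
    have h2 := prodReflection_mem τ h
    rwa [map_sub] at h2
  map_add' x y := by
    obtain ⟨a, rfl⟩ := coronaMk_surjective x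
    obtain ⟨b, rfl⟩ := coronaMk_surjective y
    exact congrArg (coronaMk ι) ((prodReflection τ).toLinearMap.map_add a b)
  map_smul' c x := by
    obtain ⟨a, rfl⟩ := coronaMk_surjective x
    exact congrArg (coronaMk ι) ((prodReflection τ).toLinearMap.map_smul c a)

theorem coronaMap_coronaMk (τ : ∀ k, Reflection (Matrix (ι k) (ι k) ℂ)) (a : matProd ι) :
    coronaMap τ (coronaMk ι a) = coronaMk ι (prodReflection τ a) := rfl

/-- The reflection induced on the corona `∏ M_{d_k} / ⊕ M_{d_k}` by a sequence of reflections on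
the matrix algebras. -/
def coronaReflection (τ : ∀ k, Reflection (Matrix (ι k) (ι k) ℂ)) : Reflection (matCorona ι) where
  toLinearMap := coronaMap τ
  map_mul x y := by
    obtain ⟨a, rfl⟩ := coronaMk_surjective x
    obtain ⟨b, rfl⟩ := coronaMk_surjective y
    rw [← map_mul, coronaMap_coronaMk, coronaMap_coronaMk, coronaMap_coronaMk,
      (prodReflection τ).map_mul, map_mul]
  map_star x := by
    obtain ⟨a, rfl⟩ := coronaMk_surjective x
    rw [star_coronaMk, coronaMap_coronaMk, coronaMap_coronaMk, (prodReflection τ).map_star,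
      star_coronaMk]
  involutive x := by
    obtain ⟨a, rfl⟩ := coronaMk_surjective x
    rw [coronaMap_coronaMk, coronaMap_coronaMk, (prodReflection τ).involutive]

theorem coronaReflection_coronaMk (τ : ∀ k, Reflection (Matrix (ι k) (ι k) ℂ)) (a : matProd ι) :
    coronaReflection τ (coronaMk ι a) = coronaMk ι (prodReflection τ a) := rfl

end Corona

/-! ### Opening gaps at interior points of `1`-cells -/

section Gap

variable {X : Type*} [TopologicalSpace X] [CWComplex (univ : Set X)]

/-- The characteristic map `(-1, 1) → X` of a `1`-cell, as a function of a real parameter. -/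
def edgeMap (e : RelCWComplex.cell (univ : Set X) 1) (s : ℝ) : X :=
  RelCWComplex.map (C := (univ : Set X)) 1 e (fun _ => s)

/-- `X` with gaps opened up at the points of `P` (to be used for `P` contained in the union of the
open `1`-cells). Every `p ∈ P` is removed from `X`, and replaced by the two endpoints
`(p, false)`, `(p, true)` of the arcs that lead to `p`. -/
def GapSpace (P : Set X) : Type _ := {x : X // x ∉ P} ⊕ (P × Bool)

/-- A point of `X` outside `P`, in the gapped space. -/
def GapSpace.old {P : Set X} (x : X) (hx : x ∉ P) : GapSpace P := Sum.inl ⟨x, hx⟩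

/-- One of the two new endpoints at `p ∈ P`; `false` is the end of the arc that comes to `p` from
smaller parameter values of the `1`-cell, `true` the end of the arc on the other side. -/
def GapSpace.endpoint {P : Set X} (p : P) (b : Bool) : GapSpace P := Sum.inr (p, b)

/-- The side of the parameter `s` on which the endpoint labelled `b` lies. -/
def sideFilter (b : Bool) (s : ℝ) : Filter ℝ := if b then 𝓝[>] s else 𝓝[<] s

/-- A set `U` is open in the gapped space if its part in `X \ P` is open there and, whenever `U`
contains an endpoint at `p = edgeMap e s`, it contains the points `edgeMap e r` for `r` close to
`s` on the side of that endpoint. -/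
instance (P : Set X) : TopologicalSpace (GapSpace P) where
  IsOpen U := IsOpen {x : {x : X // x ∉ P} | GapSpace.old x.1 x.2 ∈ U} ∧
    ∀ (p : P) (b : Bool), GapSpace.endpoint p b ∈ U →
      ∀ (e : RelCWComplex.cell (univ : Set X) 1), ∀ s ∈ Ioo (-1 : ℝ) 1, edgeMap e s = p →
        ∀ᶠ r in sideFilter b s, ∀ h : edgeMap e r ∉ P, GapSpace.old (edgeMap e r) h ∈ U
  isOpen_univ := ⟨by simp, by simp⟩
  isOpen_inter := by
    rintro U V ⟨hU, hU'⟩ ⟨hV, hV'⟩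
    refine ⟨hU.inter hV, fun p b hp e s hs hes => ?_⟩
    filter_upwards [hU' p b hp.1 e s hs hes, hV' p b hp.2 e s hs hes] with r h1 h2 h
    exact ⟨h1 h, h2 h⟩
  isOpen_sUnion := by
    intro S hS
    refine ⟨?_, ?_⟩
    · have h : {x : {x : X // x ∉ P} | GapSpace.old x.1 x.2 ∈ ⋃₀ S}
          = ⋃ U ∈ S, {x : {x : X // x ∉ P} | GapSpace.old x.1 x.2 ∈ U} := by
        ext x
        simp
      rw [h]
      exact isOpen_biUnion fun U hU => (hS U hU).1
    · rintro p b ⟨U, hU, hp⟩ e s hs hes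
      filter_upwards [(hS U hU).2 p b hp e s hs hes] with r h1 h
      exact ⟨U, hU, h1 h⟩

theorem continuousAt_edgeMap (e : RelCWComplex.cell (univ : Set X) 1) {s : ℝ}
    (hs : s ∈ Ioo (-1 : ℝ) 1) : ContinuousAt (edgeMap e) s := by
  have hmem : (fun _ : Fin 1 => s) ∈ Metric.ball (0 : Fin 1 → ℝ) 1 := by
    rw [mem_ball_zero_iff, pi_norm_lt_iff one_pos]
    intro _
    rw [Real.norm_eq_abs, abs_lt]
    exact hs
  have h1 : ContinuousAt (RelCWComplex.map (C := (univ : Set X)) 1 e) (fun _ : Fin 1 => s) :=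
    (RelCWComplex.continuousOn (C := (univ : Set X)) 1 e).continuousAt
      (mem_of_superset (Metric.isOpen_ball.mem_nhds hmem) Metric.ball_subset_closedBall)
  have h2 : ContinuousAt (fun r : ℝ => (fun _ : Fin 1 => r)) s := by fun_prop
  exact ContinuousAt.comp (f := fun r : ℝ => (fun _ : Fin 1 => r)) h1 h2

/-- The map from the gapped space to `X` that collapses every gap to a point: both endpoints at
`p` go to `p`, and all other points stay where they are. -/
def collapse (P : Set X) : C(GapSpace P, X) where
  toFun := Sum.elim (fun x => x.1) (fun q => q.1.1)
  continuous_toFun := by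
    refine continuous_def.2 fun V hV => ⟨hV.preimage continuous_subtype_val, ?_⟩
    intro p b hp e s hs hes
    have hV' : V ∈ 𝓝 (edgeMap e s) := hV.mem_nhds (by rw [hes]; exact hp)
    have h := (continuousAt_edgeMap e hs).eventually hV'
    have hle : sideFilter b s ≤ 𝓝 s := by
      cases b
      · exact nhdsWithin_le_nhds
      · exact nhdsWithin_le_nhds
    filter_upwards [hle h] with r hr _
    exact hr

/-- The `*`-homomorphism `C(X) → C(X^{[P]})`, `f ↦ f ∘ collapse`. -/
def collapseHom (P : Set X) : C(X, ℂ) →⋆ₙₐ[ℂ] C(GapSpace P, ℂ) :=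
  ((collapse P).compStarAlgHom' ℂ ℂ : C(X, ℂ) →⋆ₐ[ℂ] C(GapSpace P, ℂ)).toNonUnitalStarAlgHom

end Gap

end TauAlg

end

/-!
The topological part of the statement rests on the fact that, in a complex of dimension at most
`1`, the open edges are open subsets. Hence each end of an edge at a point `p ∈ P` converges to its
endpoint (`tendsto_toGap_edgeMap`), and a set that is a neighbourhood of both endpoints at `p`
contains the inverse image of a neighbourhood of `p` (`comap_collapse_nhds_le_of_mem`). This gives
compactness. The two endpoints at `p` are separated by a continuous function `gapJump` with a single
jump at `p`, which gives the Hausdorff property. The reflection `σ` is forced on the dense subset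
`X \ P`, and it extends to the endpoints since `τ` maps the two sides of `p` to the two sides of
`τ p` (`exists_side`).

For the extension of `φ`, the observation is that `C(X^{[2n]})` is the direct sum of `C(X)` and the
span of `2n` functions `h_p`, one for each gap, where `h_p` is supported near `p` and has a single
jump of height `1`, at `p`. A `*`-homomorphism `ψ` that extends `φ` is therefore obtained from
self-adjoint elements `H_p` of the corona with
`H_p ^ 2 = H_p + φ(h_p ^ 2 - h_p)`, `φ(f) H_p = f(p) H_p + φ((f - f(p)) h_p)` for `f ∈ C(X)`
and `H_p H_q = 0` for `p ≠ q`, where `h_p ^ 2 - h_p` and `(f - f(p)) h_p` are continuous on `X`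
(`JumpSystem.exists_starHom_extension`); the last relation follows from the second one.

The elements `H_p` come from discontinuous functions of matrices (`exists_jump_element`). Let
`θ : X → 𝕋` wrap a small arc around `p` once around the circle, with `θ⁻¹(1) = {p}` and `θ = -1` off
the arc, and let `jump` be the function on the circle with a single jump at `1` for which
`h_p = jump ∘ θ`. Extended to be unital at the base point `-1`, the restriction of `φ` to functions
of `θ` gives a unitary in the corona, which lifts to a sequence of unitary matrices `w_k` by polar
decomposition (`exists_unitary_lift`). As `φ` is automatically bounded, it agrees on the continuous
functions of `θ` with the functional calculus of `(w_k)` (`starHom_circle_eq_funCalc`). Since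
matrices have finite spectrum, `jump(w_k)` makes sense too, and `H_p` is the class of this sequence.

The reflection poses no obstruction, because the points come in pairs: with `H_x` chosen for
`x = x_i`, the element `H_y` for `y = τ(x_i)` is taken to be the image of `H_x` under the reflection
of the corona, and `h_y` is taken to be `h_x ∘ σ`. The relations are symmetric under
antimultiplicative maps, and `ψ` intertwines the reflections on the generators `C(X)` and `h_p`.
-/

noncomputable section

namespace TauAlg

open Topology Filter Set
open scoped Matrix.Norms.L2Operator

/-! ### Estimates in C*-algebras -/

theorem norm_mul_self_le_norm_star_mul_self_add {A : Type*} [CStarAlgebra A] (a b : A) :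
    ‖a‖ * ‖a‖ ≤ ‖star a * a + star b * b‖ := by
  let := CStarAlgebra.spectralOrder A
  have := CStarAlgebra.spectralOrderedRing A
  rw [← CStarRing.norm_star_mul_self]
  exact CStarAlgebra.norm_le_norm_of_nonneg_of_le (star_mul_self_nonneg a)
    (le_add_of_nonneg_right (star_mul_self_nonneg b))

/-- The isometric part of the polar decomposition: an element that is almost an isometry is close
to the isometry `a (a* a)^{-1/2}`. -/
theorem exists_isometry_near {A : Type*} [CStarAlgebra A] (a : A) {δ : ℝ} (hδ : δ ≤ 1 / 2)
    (ha : ‖star a * a - 1‖ ≤ δ) : ∃ w : A, star w * w = 1 ∧ ‖w - a‖ ≤ 4 * δ := by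
  have hδ0 : 0 ≤ δ := (norm_nonneg _).trans ha
  set b := star a * a with hb
  have hbsa : IsSelfAdjoint b := IsSelfAdjoint.star_mul_self a
  have hspec : ∀ x ∈ spectrum ℝ b, |x - 1| ≤ δ := by
    intro x hx
    have h1 : cfc (fun x : ℝ => x - 1) b = b - 1 := by
      rw [cfc_sub _ _ b, cfc_id' ℝ b, cfc_const_one ℝ b]
    have h2 := norm_apply_le_norm_cfc (fun x : ℝ => x - 1) b hx
    rw [h1] at h2
    exact h2.trans ha
  have hpos : ∀ x ∈ spectrum ℝ b, 1 / 2 ≤ x := fun x hx => by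
    have := abs_le.1 (hspec x hx)
    linarith
  set r : ℝ → ℝ := fun x => (√x)⁻¹ with hr
  have hrc : ContinuousOn r (spectrum ℝ b) := by
    refine ContinuousOn.inv₀ Real.continuous_sqrt.continuousOn fun x hx => ?_
    have := hpos x hx
    positivity
  have hrsa : IsSelfAdjoint (cfc r b) := cfc_predicate r b
  have hmul : cfc r b * b * cfc r b = 1 := by
    nth_rewrite 2 [← cfc_id' ℝ b]
    rw [← cfc_mul _ _ b, ← cfc_mul _ _ b, ← cfc_const_one ℝ b]
    refine cfc_congr fun x hx => ?_
    have h0 : 0 < x := by have := hpos x hx; linarith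
    have h1 : √x ≠ 0 := (Real.sqrt_pos.2 h0).ne'
    have h2 : √x * √x = x := Real.mul_self_sqrt h0.le
    simp only [hr]
    field_simp
    nlinarith
  have hnear : ‖cfc r b - 1‖ ≤ 2 * δ := by
    rw [← cfc_const_one ℝ b, ← cfc_sub _ _ b]
    refine norm_cfc_le (by positivity) fun x hx => ?_
    have h0 : 0 < x := by have := hpos x hx; linarith
    have h1 : 0 < √x := Real.sqrt_pos.2 h0
    have h2 : √x * √x = x := Real.mul_self_sqrt h0.le
    have h3 : 1 / 2 ≤ √x := Real.le_sqrt_of_sq_le (by have := hpos x hx; norm_num; linarith)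
    have h4 := abs_le.1 (hspec x hx)
    have h5 : (√x)⁻¹ ≤ 2 := by
      rw [inv_le_comm₀ h1 two_pos]
      linarith
    have h6 : (√x)⁻¹ - 1 = (√x)⁻¹ * (1 - √x) := by field_simp
    rw [Real.norm_eq_abs, hr, h6, abs_mul, abs_of_pos (inv_pos.2 h1)]
    have h7 : |1 - √x| ≤ δ := by
      rw [abs_le]
      constructor <;> nlinarith
    exact mul_le_mul h5 h7 (abs_nonneg _) two_pos.le
  have hanorm : ‖a‖ ≤ 2 := by
    have h1 : ‖a‖ * ‖a‖ = ‖b‖ := CStarRing.norm_star_mul_self.symm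
    have h2 : ‖b‖ ≤ 1 + δ := by
      rw [← cfc_id' ℝ b]
      refine norm_cfc_le (by positivity) fun x hx => ?_
      have := abs_le.1 (hspec x hx)
      rw [Real.norm_eq_abs, abs_le]
      constructor <;> linarith
    nlinarith [norm_nonneg a]
  refine ⟨a * cfc r b, ?_, ?_⟩
  · rw [star_mul, hrsa.star_eq, mul_assoc, ← mul_assoc (star a), ← hb, ← mul_assoc, hmul]
  · have h1 : a * cfc r b - a = a * (cfc r b - 1) := by rw [mul_sub, mul_one]
    rw [h1]
    calc ‖a * (cfc r b - 1)‖ ≤ ‖a‖ * ‖cfc r b - 1‖ := norm_mul_le _ _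
      _ ≤ 2 * (2 * δ) := mul_le_mul hanorm hnear (norm_nonneg _) two_pos.le
      _ = 4 * δ := by ring

theorem norm_le_one_of_mem_unitary {A : Type*} [CStarAlgebra A] {w : A} (hw : w ∈ unitary A) :
    ‖w‖ ≤ 1 := by
  nontriviality A
  exact (CStarRing.norm_of_mem_unitary hw).le

theorem exists_unitary_matrix_near {m : Type*} [Fintype m] [DecidableEq m] (a : Matrix m m ℂ) :
    ∃ w ∈ unitary (Matrix m m ℂ), ‖star a * a - 1‖ ≤ 1 / 2 →
      ‖w - a‖ ≤ 4 * ‖star a * a - 1‖ := by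
  by_cases h : ‖star a * a - 1‖ ≤ 1 / 2
  · obtain ⟨w, hw, hw'⟩ := exists_isometry_near a h le_rfl
    exact ⟨w, Unitary.mem_iff.2 ⟨hw, mul_eq_one_comm.1 hw⟩, fun _ => hw'⟩
  · exact ⟨1, one_mem _, fun h' => absurd h' h⟩

/-! ### Norm estimates in the matrix corona -/

section Corona

variable {ι : ℕ → Type} [∀ k, Fintype (ι k)] [∀ k, DecidableEq (ι k)]

instance : StarModule ℂ (matCorona ι) where
  star_smul r x := by
    obtain ⟨a, rfl⟩ := coronaMk_surjective x
    rw [star_coronaMk, ← map_smul, ← map_smul, star_coronaMk, star_smul]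

/-- The bound `limsup ‖a_k‖ ≤ c` for the class of `(a_k)` in the corona, in the form that some
representative satisfies `‖a_k‖ ≤ c` eventually. -/
def EventuallyNormLE (x : matCorona ι) (c : ℝ) : Prop :=
  ∃ a : matProd ι, coronaMk ι a = x ∧ ∀ᶠ k in atTop, ‖a.1 k‖ ≤ c

theorem EventuallyNormLE.add {x y : matCorona ι} {c d : ℝ} (hx : EventuallyNormLE x c)
    (hy : EventuallyNormLE y d) : EventuallyNormLE (x + y) (c + d) := by
  obtain ⟨a, rfl, ha⟩ := hx
  obtain ⟨b, rfl, hb⟩ := hy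
  refine ⟨a + b, map_add _ _ _, ?_⟩
  filter_upwards [ha, hb] with k h1 h2
  exact (norm_add_le (a.1 k) (b.1 k)).trans (add_le_add h1 h2)

theorem EventuallyNormLE.mul {x y : matCorona ι} {c d : ℝ} (hx : EventuallyNormLE x c)
    (hy : EventuallyNormLE y d) (hc : 0 ≤ c) : EventuallyNormLE (x * y) (c * d) := by
  obtain ⟨a, rfl, ha⟩ := hx
  obtain ⟨b, rfl, hb⟩ := hy
  refine ⟨a * b, map_mul _ _ _, ?_⟩
  filter_upwards [ha, hb] with k h1 h2
  exact (norm_mul_le (a.1 k) (b.1 k)).trans (mul_le_mul h1 h2 (norm_nonneg _) hc)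

theorem exists_eventuallyNormLE (x : matCorona ι) : ∃ c, 0 ≤ c ∧ EventuallyNormLE x c := by
  obtain ⟨a, rfl⟩ := coronaMk_surjective x
  obtain ⟨c, hc⟩ := a.2
  exact ⟨c, (norm_nonneg _).trans (hc 0), a, rfl, Eventually.of_forall hc⟩

theorem coronaMk_eq_zero_iff {a : matProd ι} :
    coronaMk ι a = 0 ↔ Tendsto (fun k => ‖a.1 k‖) atTop (𝓝 0) := by
  rw [← map_zero (coronaMk ι), coronaMk_eq_iff, sub_zero]
  rfl

theorem tendsto_norm_sub_of_coronaMk_eq {a b : matProd ι} (h : coronaMk ι a = coronaMk ι b) :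
    Tendsto (fun k => ‖a.1 k - b.1 k‖) atTop (𝓝 0) :=
  coronaMk_eq_iff.1 h

theorem eq_zero_of_forall_eventuallyNormLE {x : matCorona ι} {C : ℝ}
    (h : ∀ ε > 0, EventuallyNormLE x (C * ε)) : x = 0 := by
  obtain ⟨a, rfl⟩ := coronaMk_surjective x
  rw [coronaMk_eq_zero_iff, Metric.tendsto_nhds]
  intro ε hε
  have hC : 0 < |C| + 1 := by positivity
  obtain ⟨b, hb, hb'⟩ := h (ε / 2 / (|C| + 1)) (by positivity)
  have h1 := (tendsto_norm_sub_of_coronaMk_eq hb.symm).eventually (gt_mem_nhds (half_pos hε))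
  filter_upwards [hb', h1] with k h2 h3
  have h4 : C * (ε / 2 / (|C| + 1)) ≤ ε / 2 := by
    rw [mul_div_assoc', div_le_iff₀ hC]
    nlinarith [le_abs_self C]
  have h5 : ‖a.1 k‖ ≤ ‖a.1 k - b.1 k‖ + ‖b.1 k‖ := norm_le_norm_sub_add _ _
  rw [Real.dist_eq, sub_zero, abs_of_nonneg (norm_nonneg _)]
  linarith

/-- A `*`-homomorphism from a commutative C*-algebra to the corona is bounded, because
`‖f‖ ≤ ε` means that `ε² - f* f` has the form `g* g`. -/
theorem exists_bound_of_starHom {X : Type*} [TopologicalSpace X]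
    (φ : C(X, ℂ) →⋆ₙₐ[ℂ] matCorona ι) :
    ∃ C, 0 ≤ C ∧ ∀ (f : C(X, ℂ)) (ε : ℝ), 0 < ε → (∀ x, ‖f x‖ ≤ ε) →
      EventuallyNormLE (φ f) (C * ε) := by
  obtain ⟨e, he⟩ := coronaMk_surjective (φ 1)
  obtain ⟨c, hc⟩ := e.2
  have hc0 : 0 ≤ c := (norm_nonneg _).trans (hc 0)
  refine ⟨c + 1, by positivity, fun f ε hε hf => ?_⟩
  let g : C(X, ℂ) := ⟨fun x => ((√(ε ^ 2 - ‖f x‖ ^ 2) : ℝ) : ℂ), by fun_prop⟩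
  have hfg : star f * f + star g * g = ((ε : ℂ) ^ 2) • (1 : C(X, ℂ)) := by
    ext x
    have h1 : 0 ≤ ε ^ 2 - ‖f x‖ ^ 2 := by
      have := hf x
      have := norm_nonneg (f x)
      nlinarith
    have h2 : (starRingEnd ℂ) (f x) * f x = ((‖f x‖ ^ 2 : ℝ) : ℂ) := by
      rw [Complex.conj_mul']
      push_cast
      rfl
    have h3 : (starRingEnd ℂ) (g x) * g x = ((ε ^ 2 - ‖f x‖ ^ 2 : ℝ) : ℂ) := by
      change (starRingEnd ℂ) ((√(ε ^ 2 - ‖f x‖ ^ 2) : ℝ) : ℂ) * ((√(ε ^ 2 - ‖f x‖ ^ 2) : ℝ) : ℂ) = _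
      rw [Complex.conj_ofReal, ← Complex.ofReal_mul, Real.mul_self_sqrt h1]
    simp only [ContinuousMap.add_apply, ContinuousMap.mul_apply, ContinuousMap.star_apply,
      ContinuousMap.smul_apply, ContinuousMap.one_apply, smul_eq_mul, mul_one, RCLike.star_def]
    rw [h2, h3]
    push_cast
    ring
  obtain ⟨a, ha⟩ := coronaMk_surjective (φ f)
  obtain ⟨b, hb⟩ := coronaMk_surjective (φ g)
  refine ⟨a, ha, ?_⟩
  have h1 : coronaMk ι (star a * a + star b * b) = coronaMk ι (((ε : ℂ) ^ 2) • e) := by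
    rw [map_add, map_mul, map_mul, ← star_coronaMk, ← star_coronaMk, map_smul, ha, hb, he,
      ← map_star, ← map_star, ← map_mul, ← map_mul, ← map_add, hfg, map_smul]
  have h2 := (tendsto_norm_sub_of_coronaMk_eq h1).eventually (gt_mem_nhds (pow_pos hε 2))
  filter_upwards [h2] with k hk
  have h3 : ‖star (a.1 k) * a.1 k + star (b.1 k) * b.1 k‖ ≤ ε ^ 2 + ε ^ 2 * c := by
    have h4 := norm_le_norm_sub_add (star (a.1 k) * a.1 k + star (b.1 k) * b.1 k)
      (((ε : ℂ) ^ 2) • e.1 k)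
    have h5 : ‖((ε : ℂ) ^ 2) • e.1 k‖ ≤ ε ^ 2 * c := by
      rw [norm_smul, norm_pow, Complex.norm_real, Real.norm_of_nonneg hε.le]
      exact mul_le_mul_of_nonneg_left (hc k) (by positivity)
    exact h4.trans (add_le_add hk.le h5)
  have h6 := (norm_mul_self_le_norm_star_mul_self_add (a.1 k) (b.1 k)).trans h3
  refine abs_le_of_sq_le_sq' (a := ‖a.1 k‖) (b := (c + 1) * ε) ?_ (by positivity) |>.2
  nlinarith [mul_nonneg hc0 (sq_nonneg ε), mul_nonneg (mul_nonneg hc0 hc0) (sq_nonneg ε)]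

/-- Unitaries lift from the corona to sequences of unitary matrices. -/
theorem exists_unitary_lift {u : matCorona ι} (hu : star u * u = 1) :
    ∃ w : matProd ι, coronaMk ι w = u ∧ ∀ k, w.1 k ∈ unitary (Matrix (ι k) (ι k) ℂ) := by
  obtain ⟨a, rfl⟩ := coronaMk_surjective u
  have h1 : coronaMk ι (star a * a) = coronaMk ι 1 := by
    rw [map_mul, ← star_coronaMk, hu, map_one]
  have h2 := tendsto_norm_sub_of_coronaMk_eq h1
  have h3 : ∀ k, (star a * a).1 k - (1 : matProd ι).1 k = star (a.1 k) * a.1 k - 1 := fun _ => rfl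
  simp only [h3] at h2
  choose w hw hw' using fun k => exists_unitary_matrix_near (a.1 k)
  refine ⟨⟨w, 1, fun k => norm_le_one_of_mem_unitary (hw k)⟩, ?_, hw⟩
  rw [coronaMk_eq_iff]
  change Tendsto (fun k => ‖w k - a.1 k‖) atTop (𝓝 0)
  have h4 : Tendsto (fun k => 4 * ‖star (a.1 k) * a.1 k - 1‖) atTop (𝓝 0) := by
    simpa using h2.const_mul 4
  refine squeeze_zero' (Eventually.of_forall fun k => norm_nonneg _) ?_ h4
  filter_upwards [h2.eventually (gt_mem_nhds (one_half_pos (α := ℝ)))] with k hk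
  exact hw' k hk.le

end Corona

/-! ### Functions of a unitary in the matrix corona -/

section Unitary

variable {ι : ℕ → Type} [∀ k, Fintype (ι k)] [∀ k, DecidableEq (ι k)]

theorem continuousOn_spectrum_matrix {m : Type*} [Fintype m] [DecidableEq m] (a : Matrix m m ℂ)
    (v : ℂ → ℂ) : ContinuousOn v (spectrum ℂ a) :=
  (Matrix.finite_spectrum a).continuousOn v

/-- The sequence `v(w_k)`, for a sequence of unitary matrices `w_k` and an arbitrary function `v`,
bounded on the circle. Since matrices have finite spectrum, the continuous functional calculus
applies to discontinuous `v` as well. -/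
def funCalc (w : matProd ι) (hw : ∀ k, w.1 k ∈ unitary (Matrix (ι k) (ι k) ℂ)) (v : ℂ → ℂ)
    (hv : ∃ c, ∀ z ∈ Metric.sphere (0 : ℂ) 1, ‖v z‖ ≤ c) : matProd ι :=
  ⟨fun k => cfc v (w.1 k), by
    obtain ⟨c, hc⟩ := hv
    exact ⟨max c 0, fun k => norm_cfc_le (le_max_right _ _) fun z hz =>
      (hc z (spectrum.subset_circle_of_unitary (hw k) hz)).trans (le_max_left _ _)⟩⟩

section

variable {w : matProd ι} {hw : ∀ k, w.1 k ∈ unitary (Matrix (ι k) (ι k) ℂ)} {v v' v'' : ℂ → ℂ}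
  {hv : ∃ c, ∀ z ∈ Metric.sphere (0 : ℂ) 1, ‖v z‖ ≤ c}
  {hv' : ∃ c, ∀ z ∈ Metric.sphere (0 : ℂ) 1, ‖v' z‖ ≤ c}
  {hv'' : ∃ c, ∀ z ∈ Metric.sphere (0 : ℂ) 1, ‖v'' z‖ ≤ c}

theorem funCalc_mul (h : ∀ z ∈ Metric.sphere (0 : ℂ) 1, v'' z = v z * v' z) :
    funCalc w hw v'' hv'' = funCalc w hw v hv * funCalc w hw v' hv' := by
  refine Subtype.ext (funext fun k => ?_)
  change cfc v'' (w.1 k) = cfc v (w.1 k) * cfc v' (w.1 k)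
  rw [← cfc_mul v v' (w.1 k) (continuousOn_spectrum_matrix _ _) (continuousOn_spectrum_matrix _ _)]
  exact cfc_congr fun z hz => h z (spectrum.subset_circle_of_unitary (hw k) hz)

theorem funCalc_add (h : ∀ z ∈ Metric.sphere (0 : ℂ) 1, v'' z = v z + v' z) :
    funCalc w hw v'' hv'' = funCalc w hw v hv + funCalc w hw v' hv' := by
  refine Subtype.ext (funext fun k => ?_)
  change cfc v'' (w.1 k) = cfc v (w.1 k) + cfc v' (w.1 k)
  rw [← cfc_add (w.1 k) v v' (continuousOn_spectrum_matrix _ _) (continuousOn_spectrum_matrix _ _)]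
  exact cfc_congr fun z hz => h z (spectrum.subset_circle_of_unitary (hw k) hz)

theorem star_funCalc (h : ∀ z ∈ Metric.sphere (0 : ℂ) 1, v' z = star (v z)) :
    funCalc w hw v' hv' = star (funCalc w hw v hv) := by
  refine Subtype.ext (funext fun k => ?_)
  change cfc v' (w.1 k) = star (cfc v (w.1 k))
  rw [← cfc_star v (w.1 k)]
  exact cfc_congr fun z hz => h z (spectrum.subset_circle_of_unitary (hw k) hz)

theorem norm_funCalc_le {c : ℝ} (hc : 0 ≤ c) (h : ∀ z ∈ Metric.sphere (0 : ℂ) 1, ‖v z‖ ≤ c)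
    (k : ℕ) : ‖(funCalc w hw v hv).1 k‖ ≤ c :=
  norm_cfc_le hc fun z hz => h z (spectrum.subset_circle_of_unitary (hw k) hz)

end

/-- Extension of a function on the circle to the plane, by zero. -/
def circleExtend (f : C(Metric.sphere (0 : ℂ) 1, ℂ)) : ℂ → ℂ := Function.extend Subtype.val f 0

theorem circleExtend_apply (f : C(Metric.sphere (0 : ℂ) 1, ℂ)) {z : ℂ}
    (hz : z ∈ Metric.sphere (0 : ℂ) 1) : circleExtend f z = f ⟨z, hz⟩ :=
  Subtype.val_injective.extend_apply f 0 ⟨z, hz⟩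

theorem circleExtend_bounded (f : C(Metric.sphere (0 : ℂ) 1, ℂ)) :
    ∃ c, ∀ z ∈ Metric.sphere (0 : ℂ) 1, ‖circleExtend f z‖ ≤ c :=
  ⟨‖f‖, fun z hz => by
    rw [circleExtend_apply f hz]
    exact f.norm_coe_le_norm _⟩

/-- A unital `*`-homomorphism from `C(𝕋)` to the corona is the functional calculus of any sequence
of unitary matrices that lifts the image of the coordinate function. -/
theorem starHom_circle_eq_funCalc (Φ : C(Metric.sphere (0 : ℂ) 1, ℂ) →⋆ₐ[ℂ] matCorona ι)
    (w : matProd ι) (hw : ∀ k, w.1 k ∈ unitary (Matrix (ι k) (ι k) ℂ))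
    (hΦ : coronaMk ι w = Φ (.restrict _ (.id ℂ))) (f : C(Metric.sphere (0 : ℂ) 1, ℂ)) :
    Φ f = coronaMk ι (funCalc w hw (circleExtend f) (circleExtend_bounded f)) := by
  have hid : funCalc w hw (circleExtend (.restrict _ (.id ℂ))) (circleExtend_bounded _) = w := by
    refine Subtype.ext (funext fun k => ?_)
    have hn : IsStarNormal (w.1 k) := isStarNormal_of_mem_unitary (hw k)
    refine Eq.trans ?_ (cfc_id' ℂ (w.1 k))
    exact cfc_congr fun z hz =>
      circleExtend_apply _ (spectrum.subset_circle_of_unitary (hw k) hz)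
  induction f using ContinuousMap.induction_on_of_compact with
  | const r =>
    have h1 : (ContinuousMap.const (Metric.sphere (0 : ℂ) 1) r) = algebraMap ℂ _ r := rfl
    have h2 : funCalc w hw (circleExtend (.const _ r)) (circleExtend_bounded _)
        = algebraMap ℂ (matProd ι) r := by
      refine Subtype.ext (funext fun k => ?_)
      have hn : IsStarNormal (w.1 k) := isStarNormal_of_mem_unitary (hw k)
      refine Eq.trans ?_ (cfc_const r (w.1 k))
      exact cfc_congr fun z hz =>
        circleExtend_apply _ (spectrum.subset_circle_of_unitary (hw k) hz)
    rw [h2, h1, AlgHomClass.commutes, AlgHomClass.commutes]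
  | id => rw [hid, hΦ]
  | star_id =>
    rw [map_star, ← hΦ, star_coronaMk]
    refine congrArg _ ((congrArg star hid).symm.trans (star_funCalc fun z hz => ?_).symm)
    rw [circleExtend_apply _ hz, circleExtend_apply _ hz]
    rfl
  | add f g hf hg =>
    rw [map_add, hf, hg, ← map_add]
    refine congrArg _ (funCalc_add fun z hz => ?_).symm
    rw [circleExtend_apply _ hz, circleExtend_apply _ hz, circleExtend_apply _ hz]
    rfl
  | mul f g hf hg =>
    rw [map_mul, hf, hg, ← map_mul]
    refine congrArg _ (funCalc_mul fun z hz => ?_).symm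
    rw [circleExtend_apply _ hz, circleExtend_apply _ hz, circleExtend_apply _ hz]
    rfl
  | frequently f hf =>
    obtain ⟨C, hC0, hC⟩ := exists_bound_of_starHom Φ.toNonUnitalStarAlgHom
    rw [← sub_eq_zero]
    refine eq_zero_of_forall_eventuallyNormLE (C := C + 1) fun ε hε => ?_
    obtain ⟨g, hg, hgf⟩ := (hf.and_eventually (Metric.ball_mem_nhds f hε)).exists
    have hfg : ∀ z, ‖(f - g) z‖ ≤ ε := fun z => by
      have h1 : ‖f - g‖ < ε := by rwa [dist_comm, dist_eq_norm] at hgf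
      exact ((f - g).norm_coe_le_norm z).trans h1.le
    have h1 : EventuallyNormLE (Φ (f - g)) (C * ε) := hC _ ε hε hfg
    have h2 : EventuallyNormLE
        (coronaMk ι (funCalc w hw (circleExtend (g - f)) (circleExtend_bounded _))) ε := by
      refine ⟨_, rfl, Eventually.of_forall (norm_funCalc_le hε.le fun z hz => ?_)⟩
      rw [circleExtend_apply _ hz]
      have := hfg ⟨z, hz⟩
      rwa [ContinuousMap.sub_apply, norm_sub_rev] at this
    have h3 : funCalc w hw (circleExtend g) (circleExtend_bounded _)
        = funCalc w hw (circleExtend (g - f)) (circleExtend_bounded _)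
          + funCalc w hw (circleExtend f) (circleExtend_bounded _) := funCalc_add fun z hz => by
      rw [circleExtend_apply _ hz, circleExtend_apply _ hz, circleExtend_apply _ hz]
      simp
    have h4 := h1.add h2
    rw [map_sub, hg, h3, map_add] at h4
    convert h4 using 1
    · abel
    · ring

end Unitary

/-! ### The jump function on the circle -/

/-- The function on the circle that jumps from `0` to `1` at the point `1` and is continuous
elsewhere: it vanishes on the closed lower half, and is `max (Re z) 0` on the open upper half. -/
def jump (z : ℂ) : ℂ := if 0 < z.im then ((max z.re 0 : ℝ) : ℂ) else 0

theorem jump_of_im_pos {z : ℂ} (h : 0 < z.im) : jump z = ((max z.re 0 : ℝ) : ℂ) := if_pos h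

theorem jump_of_im_nonpos {z : ℂ} (h : z.im ≤ 0) : jump z = 0 := if_neg h.not_gt

theorem jump_of_re_nonpos {z : ℂ} (h : z.re ≤ 0) : jump z = 0 := by
  simp [jump, max_eq_right h]

theorem star_jump (z : ℂ) : star (jump z) = jump z := by
  unfold jump
  split_ifs <;> simp

theorem norm_jump_le {z : ℂ} (hz : ‖z‖ = 1) : ‖jump z‖ ≤ 1 := by
  unfold jump
  split_ifs
  · rw [Complex.norm_real, Real.norm_of_nonneg (le_max_right _ _)]
    exact max_le (hz ▸ Complex.re_le_norm z) zero_le_one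
  · simp

theorem jump_mul_self (z : ℂ) : jump z * jump z = ((max z.re 0 : ℝ) : ℂ) * jump z := by
  unfold jump
  split_ifs <;> simp

theorem continuousAt_jump {z : ℂ} (hz : ‖z‖ = 1) (h1 : z ≠ 1) : ContinuousAt jump z := by
  rcases lt_trichotomy z.im 0 with h | h | h
  · refine (continuousAt_const (y := (0 : ℂ))).congr ?_
    filter_upwards [Complex.continuous_im.continuousAt.eventually (gt_mem_nhds h)] with y hy
    exact (jump_of_im_nonpos (le_of_lt hy)).symm
  · have hre : z.re < 0 := by
      have h2 : z.re * z.re = 1 := by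
        have := Complex.normSq_eq_norm_sq z
        rw [Complex.normSq_apply, hz, h] at this
        linarith
      rcases mul_self_eq_one_iff.1 h2 with h3 | h3
      · exact absurd (Complex.ext h3 h) h1
      · rw [h3]
        norm_num
    refine (continuousAt_const (y := (0 : ℂ))).congr ?_
    filter_upwards [Complex.continuous_re.continuousAt.eventually (gt_mem_nhds hre)] with y hy
    exact (jump_of_re_nonpos (le_of_lt hy)).symm
  · have h2 : Continuous fun y : ℂ => ((max y.re 0 : ℝ) : ℂ) := by fun_prop
    refine h2.continuousAt.congr ?_
    filter_upwards [Complex.continuous_im.continuousAt.eventually (lt_mem_nhds h)] with y hy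
    exact (jump_of_im_pos hy).symm

/-- A factor that vanishes at `1` removes the discontinuity of `jump`. -/
theorem continuousOn_mul_jump {β : ℂ → ℂ} (hβ : Continuous β) (h1 : β 1 = 0) :
    ContinuousOn (fun z => β z * jump z) (Metric.sphere (0 : ℂ) 1) := by
  intro z hz
  have hz' : ‖z‖ = 1 := mem_sphere_zero_iff_norm.1 hz
  by_cases h : z = 1
  · subst h
    have h2 : Tendsto (fun z => ‖β z‖) (𝓝[Metric.sphere (0 : ℂ) 1] 1) (𝓝 0) := by
      have := (hβ.norm.tendsto 1).mono_left (nhdsWithin_le_nhds (s := Metric.sphere (0 : ℂ) 1))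
      rwa [h1, norm_zero] at this
    have h3 : ContinuousWithinAt (fun z => β z * jump z) (Metric.sphere (0 : ℂ) 1) 1
        ↔ Tendsto (fun z => β z * jump z) (𝓝[Metric.sphere (0 : ℂ) 1] 1) (𝓝 0) := by
      rw [ContinuousWithinAt, h1, zero_mul]
    rw [h3, tendsto_zero_iff_norm_tendsto_zero]
    refine squeeze_zero' (Eventually.of_forall fun _ => norm_nonneg _) ?_ h2
    filter_upwards [self_mem_nhdsWithin] with y hy
    rw [norm_mul]
    exact mul_le_of_le_one_right (norm_nonneg _)
      (norm_jump_le (mem_sphere_zero_iff_norm.1 hy))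
  · exact (hβ.continuousAt.mul (continuousAt_jump hz' h)).continuousWithinAt

/-! ### An element of the corona that jumps at a point -/

section JumpElement

variable {ι : ℕ → Type} [∀ k, Fintype (ι k)] [∀ k, DecidableEq (ι k)]
variable {X : Type*} [TopologicalSpace X]

/-- The composition of a function on the circle with `θ : X → 𝕋`. -/
def circlePullback (θ : C(X, ℂ)) (hθ : ∀ x, ‖θ x‖ = 1) (f : C(Metric.sphere (0 : ℂ) 1, ℂ)) :
    C(X, ℂ) :=
  f.comp ⟨fun x => ⟨θ x, mem_sphere_zero_iff_norm.2 (hθ x)⟩, by fun_prop⟩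

/-- The unital `*`-homomorphism `C(𝕋) → Q`, `f ↦ φ(f ∘ θ - f(-1)) + f(-1)`. The base point `-1`
is the value of `θ` outside of an arc, so that this is the unital extension of the restriction of
`φ` to the functions that live on the arc. -/
def circleHom (φ : C(X, ℂ) →⋆ₙₐ[ℂ] matCorona ι) (θ : C(X, ℂ)) (hθ : ∀ x, ‖θ x‖ = 1) :
    C(Metric.sphere (0 : ℂ) 1, ℂ) →⋆ₐ[ℂ] matCorona ι where
  toFun f := φ (circlePullback θ hθ f - f ⟨-1, by simp⟩ • 1) + f ⟨-1, by simp⟩ • 1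
  map_one' := by
    have h : circlePullback θ hθ 1 - (1 : ℂ) • 1 = 0 := by
      ext x
      simp [circlePullback]
    rw [ContinuousMap.one_apply, h, map_zero, zero_add, one_smul]
  map_zero' := by
    have h : circlePullback θ hθ 0 - (0 : ℂ) • 1 = 0 := by
      ext x
      simp [circlePullback]
    rw [ContinuousMap.zero_apply, h, map_zero, zero_add, zero_smul]
  map_add' f g := by
    have h : circlePullback θ hθ (f + g) = circlePullback θ hθ f + circlePullback θ hθ g := rfl
    simp only [h, map_sub, map_add, map_smul, ContinuousMap.add_apply, add_smul]
    abel
  map_mul' f g := by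
    have h : circlePullback θ hθ (f * g) = circlePullback θ hθ f * circlePullback θ hθ g := rfl
    set a := circlePullback θ hθ f with ha
    set b := circlePullback θ hθ g with hb
    set c := f ⟨-1, by simp⟩ with hc
    set d := g ⟨-1, by simp⟩ with hd
    have h1 : a * b - (c * d) • (1 : C(X, ℂ)) =
        (a - c • 1) * (b - d • 1) + c • (b - d • 1) + d • (a - c • 1) := by
      ext x
      simp
      ring
    rw [h, ContinuousMap.mul_apply, ← hc, ← hd, h1, map_add, map_add, map_mul, map_smul, map_smul,
      add_mul, mul_add, mul_add, smul_mul_assoc, one_mul, mul_smul_comm, mul_one, smul_mul_assoc,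
      mul_smul_comm, one_mul, smul_smul]
    abel
  commutes' r := by
    have h : circlePullback θ hθ (algebraMap ℂ _ r) - r • 1 = 0 := by
      ext x
      simp [circlePullback]
    have h1 : (algebraMap ℂ C(Metric.sphere (0 : ℂ) 1, ℂ) r) ⟨-1, by simp⟩ = r := rfl
    rw [h1, h, map_zero, zero_add, Algebra.algebraMap_eq_smul_one]
  map_star' f := by
    have h : circlePullback θ hθ (star f) = star (circlePullback θ hθ f) := rfl
    have h1 : ∀ z, (star f) z = star (f z) := fun _ => rfl
    rw [h, h1]
    generalize f _ = c
    rw [star_add, ← map_star, star_sub, star_smul, star_smul, star_one, star_one]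

theorem mul_circleHom (φ : C(X, ℂ) →⋆ₙₐ[ℂ] matCorona ι) (θ : C(X, ℂ)) (hθ : ∀ x, ‖θ x‖ = 1)
    (F : C(X, ℂ)) (f : C(Metric.sphere (0 : ℂ) 1, ℂ)) :
    φ F * circleHom φ θ hθ f = φ (F * circlePullback θ hθ f) := by
  change φ F * (φ (circlePullback θ hθ f - f ⟨-1, by simp⟩ • 1) + f ⟨-1, by simp⟩ • 1) = _
  rw [mul_add, ← map_mul, mul_smul_comm, mul_one, ← map_smul, ← map_add]
  congr 1
  ext x
  simp
  ring

theorem circleHom_of_apply_eq_zero (φ : C(X, ℂ) →⋆ₙₐ[ℂ] matCorona ι) (θ : C(X, ℂ))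
    (hθ : ∀ x, ‖θ x‖ = 1) (f : C(Metric.sphere (0 : ℂ) 1, ℂ)) (hf : f ⟨-1, by simp⟩ = 0) :
    circleHom φ θ hθ f = φ (circlePullback θ hθ f) := by
  change φ (circlePullback θ hθ f - f ⟨-1, by simp⟩ • 1) + f ⟨-1, by simp⟩ • 1 = _
  simp [hf]

/-- A continuous function that vanishes at `p = θ⁻¹(1)` is almost unchanged by a cut-off to the
complement of a neighbourhood of `p` that is defined in terms of `θ`. -/
theorem exists_cutoff [CompactSpace X] (θ : C(X, ℂ)) (F : C(X, ℂ))
    (hF : ∀ x, θ x = 1 → F x = 0) {ε : ℝ} (hε : 0 < ε) :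
    ∃ β : ℂ → ℂ, Continuous β ∧ β 1 = 0 ∧ ∀ x, ‖F x * (1 - β (θ x))‖ ≤ ε := by
  obtain ⟨δ, hδ, hδ'⟩ : ∃ δ > 0, ∀ x, ε ≤ ‖F x‖ → δ ≤ ‖θ x - 1‖ := by
    have hK : IsCompact {x | ε ≤ ‖F x‖} :=
      (isClosed_le continuous_const (by fun_prop)).isCompact
    rcases {x | ε ≤ ‖F x‖}.eq_empty_or_nonempty with h | h
    · exact ⟨1, one_pos, fun x hx => absurd hx (Set.eq_empty_iff_forall_notMem.1 h x)⟩
    · obtain ⟨y, hy, hmin⟩ := hK.exists_isMinOn h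
        (f := fun x => ‖θ x - 1‖) (by fun_prop)
      refine ⟨‖θ y - 1‖, norm_pos_iff.2 fun h0 => ?_, fun x hx => hmin hx⟩
      have h1 := hF y (sub_eq_zero.1 h0)
      rw [mem_ofPred_eq, h1, norm_zero] at hy
      exact hε.not_ge hy
  refine ⟨fun z => ((min 1 (‖z - 1‖ / δ) : ℝ) : ℂ), by fun_prop, by simp, fun x => ?_⟩
  have h0 : 0 ≤ min 1 (‖θ x - 1‖ / δ) := le_min zero_le_one (by positivity)
  have h1 : (1 : ℂ) - ((min 1 (‖θ x - 1‖ / δ) : ℝ) : ℂ)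
      = ((1 - min 1 (‖θ x - 1‖ / δ) : ℝ) : ℂ) := by push_cast; rfl
  rw [h1, norm_mul, Complex.norm_real,
    Real.norm_of_nonneg (sub_nonneg.2 (min_le_left _ _))]
  by_cases h : ε ≤ ‖F x‖
  · rw [min_eq_left ((one_le_div hδ).2 (hδ' x h)), sub_self, mul_zero]
    exact hε.le
  · exact (mul_le_of_le_one_right (norm_nonneg _) (by linarith)).trans (not_le.1 h).le

/-- For every `*`-homomorphism from `C(X)` to the corona there is an element of the corona that
behaves like the image of the discontinuous function `jump ∘ θ`, which jumps at `p = θ⁻¹(1)`.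
It is the image `[jump(w_k)]` of `jump` under the functional calculus of a sequence of unitary
matrices `w_k` that lifts the image of `θ`. -/
theorem exists_jump_element [CompactSpace X] (φ : C(X, ℂ) →⋆ₙₐ[ℂ] matCorona ι) (θ : C(X, ℂ))
    (hθ : ∀ x, ‖θ x‖ = 1) (p : X) (hp : ∀ x, θ x = 1 → x = p) :
    ∃ H : matCorona ι, star H = H ∧
      (∀ m : C(X, ℂ), (∀ x, m x = jump (θ x) * jump (θ x) - jump (θ x)) → H * H = H + φ m) ∧
      ∀ f g : C(X, ℂ), (∀ x, g x = (f x - f p) * jump (θ x)) →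
        φ f * H = f p • H + φ g ∧ H * φ f = f p • H + φ g := by
  set Φ := circleHom φ θ hθ with hΦ
  obtain ⟨w, hwΦ, hw⟩ := exists_unitary_lift (u := Φ (.restrict _ (.id ℂ))) (by
    rw [← map_star, ← map_mul, ← map_one Φ]
    congr 1
    ext z
    have hz : ‖(z : ℂ)‖ = 1 := mem_sphere_zero_iff_norm.1 z.2
    change (starRingEnd ℂ) (z : ℂ) * z = 1
    rw [Complex.conj_mul', hz]
    simp)
  have hjb : ∃ c, ∀ z ∈ Metric.sphere (0 : ℂ) 1, ‖jump z‖ ≤ c :=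
    ⟨1, fun z hz => norm_jump_le (mem_sphere_zero_iff_norm.1 hz)⟩
  set J := funCalc w hw jump hjb with hJ
  -- continuous multiples of `jump` are represented by `Φ`
  have hmulJ : ∀ (f g : C(Metric.sphere (0 : ℂ) 1, ℂ)), (∀ z, g z = f z * jump z) →
      Φ f * coronaMk ι J = Φ g := by
    intro f g hfg
    rw [starHom_circle_eq_funCalc Φ w hw hwΦ f, starHom_circle_eq_funCalc Φ w hw hwΦ g, ← map_mul]
    refine congrArg _ (funCalc_mul fun z hz => ?_).symm
    rw [circleExtend_apply _ hz, circleExtend_apply _ hz]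
    exact hfg ⟨z, hz⟩
  have key : ∀ F g : C(X, ℂ), F p = 0 → (∀ x, g x = F x * jump (θ x)) →
      φ F * coronaMk ι J = φ g := by
    intro F g hF hg
    obtain ⟨C, hC0, hC⟩ := exists_bound_of_starHom φ
    obtain ⟨c, hc0, hc⟩ := exists_eventuallyNormLE (coronaMk ι J)
    rw [← sub_eq_zero]
    refine eq_zero_of_forall_eventuallyNormLE (C := C * c + C) fun ε hε => ?_
    obtain ⟨β, hβ, hβ1, hβF⟩ := exists_cutoff θ F (fun x hx => by rw [hp x hx, hF]) hε
    let f1 : C(Metric.sphere (0 : ℂ) 1, ℂ) := ⟨fun z => β z, by fun_prop⟩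
    let f2 : C(Metric.sphere (0 : ℂ) 1, ℂ) :=
      ⟨fun z => β z * jump z, (continuousOn_mul_jump hβ hβ1).domRestrict⟩
    have h1 : φ F * coronaMk ι J - φ g = φ (F - F * circlePullback θ hθ f1) * coronaMk ι J
        + φ (F * circlePullback θ hθ f2 - g) := by
      rw [map_sub, map_sub, ← mul_circleHom, ← mul_circleHom, sub_mul, mul_assoc,
        ← hΦ, hmulJ f1 f2 fun _ => rfl]
      abel
    have h2 : EventuallyNormLE (φ (F - F * circlePullback θ hθ f1)) (C * ε) := by
      refine hC _ ε hε fun x => ?_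
      have h3 : (F - F * circlePullback θ hθ f1) x = F x * (1 - β (θ x)) := by
        rw [mul_sub, mul_one]
        rfl
      rw [h3]
      exact hβF x
    have h3 : EventuallyNormLE (φ (F * circlePullback θ hθ f2 - g)) (C * ε) := by
      refine hC _ ε hε fun x => ?_
      have h4 : (F * circlePullback θ hθ f2 - g) x = -(F x * (1 - β (θ x)) * jump (θ x)) := by
        have : (F * circlePullback θ hθ f2 - g) x = F x * (β (θ x) * jump (θ x)) - g x := rfl
        rw [this, hg]
        ring
      rw [h4, norm_neg, norm_mul]
      exact (mul_le_of_le_one_right (norm_nonneg _) (norm_jump_le (hθ x))).trans (hβF x)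
    rw [h1, show (C * c + C) * ε = C * ε * c + C * ε by ring]
    exact (h2.mul hc (by positivity)).add h3
  -- `J` lives on the arc, so that `φ 1` acts on it as a unit
  have hunit : φ 1 * coronaMk ι J = coronaMk ι J := by
    let f1 : C(Metric.sphere (0 : ℂ) 1, ℂ) :=
      ⟨fun z => ((min 1 (1 + (z : ℂ).re) : ℝ) : ℂ), by fun_prop⟩
    have h1 : Φ f1 = φ (circlePullback θ hθ f1) := by
      refine circleHom_of_apply_eq_zero φ θ hθ f1 ?_
      change ((min 1 (1 + (-1 : ℂ).re) : ℝ) : ℂ) = 0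
      simp
    have h2 : Φ f1 * coronaMk ι J = coronaMk ι J := by
      rw [starHom_circle_eq_funCalc Φ w hw hwΦ f1, ← map_mul]
      refine congrArg _ (funCalc_mul fun z hz => ?_).symm
      rw [circleExtend_apply _ hz]
      change jump z = ((min 1 (1 + z.re) : ℝ) : ℂ) * jump z
      by_cases h : z.re ≤ 0
      · rw [jump_of_re_nonpos h, mul_zero]
      · rw [min_eq_left (by linarith), Complex.ofReal_one, one_mul]
    rw [← h2, h1, ← mul_assoc, ← map_mul, one_mul]
  have hJstar : star (coronaMk ι J) = coronaMk ι J := by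
    rw [star_coronaMk]
    exact congrArg _ (star_funCalc fun z _ => (star_jump z).symm).symm
  have hleft : ∀ f g : C(X, ℂ), (∀ x, g x = (f x - f p) * jump (θ x)) →
      φ f * coronaMk ι J = f p • coronaMk ι J + φ g := by
    intro f g hg
    have h1 : f = f p • 1 + (f - f p • 1) := by abel
    have h2 := key (f - f p • 1) g (by simp) (fun x => by rw [hg]; simp)
    nth_rewrite 1 [h1]
    rw [map_add, add_mul, h2, map_smul, smul_mul_assoc, hunit]
  refine ⟨coronaMk ι J, hJstar, ?_, fun f g hg => ⟨hleft f g hg, ?_⟩⟩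
  · intro m hm
    let f1 : C(Metric.sphere (0 : ℂ) 1, ℂ) :=
      ⟨fun z => (((max (z : ℂ).re 0 - 1 : ℝ) : ℂ) * jump z),
        (continuousOn_mul_jump (β := fun z => ((max z.re 0 - 1 : ℝ) : ℂ)) (by fun_prop)
          (by simp)).domRestrict⟩
    have h1 : Φ f1 = φ (circlePullback θ hθ f1) := by
      refine circleHom_of_apply_eq_zero φ θ hθ f1 ?_
      change ((max (-1 : ℂ).re 0 - 1 : ℝ) : ℂ) * jump (-1) = 0
      rw [jump_of_re_nonpos (by simp), mul_zero]
    have h2 : m = circlePullback θ hθ f1 := by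
      ext x
      rw [hm, jump_mul_self]
      change _ = ((max (θ x).re 0 - 1 : ℝ) : ℂ) * jump (θ x)
      push_cast
      ring
    have hjb2 : ∃ c, ∀ z ∈ Metric.sphere (0 : ℂ) 1, ‖jump z * jump z‖ ≤ c :=
      ⟨1, fun z hz => by
        rw [norm_mul]
        have := norm_jump_le (mem_sphere_zero_iff_norm.1 hz)
        nlinarith [norm_nonneg (jump z)]⟩
    have h3 : J * J = J + funCalc w hw (circleExtend f1) (circleExtend_bounded f1) := by
      rw [hJ, ← funCalc_mul (v'' := fun z => jump z * jump z) (hv'' := hjb2) fun _ _ => rfl]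
      refine funCalc_add fun z hz => ?_
      rw [circleExtend_apply _ hz, jump_mul_self]
      change _ = jump z + ((max z.re 0 - 1 : ℝ) : ℂ) * jump z
      push_cast
      ring
    rw [h2, ← h1, starHom_circle_eq_funCalc Φ w hw hwΦ f1, ← map_mul, h3, map_add]
  · have h1 := hleft (star f) (star g) fun x => by
      rw [ContinuousMap.star_apply, hg, star_mul', star_jump, star_sub]
      rfl
    have h2 := congrArg star h1
    rwa [star_mul, star_add, star_smul, hJstar, map_star, map_star, star_star, star_star,
      ContinuousMap.star_apply, star_star] at h2

end JumpElement

/-! ### Open `1`-cells of a one-dimensional CW complex -/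

section Edge

variable {X : Type*} [TopologicalSpace X] [CWComplex (univ : Set X)]

theorem const_mem_ball_iff {s : ℝ} :
    (fun _ : Fin 1 => s) ∈ Metric.ball (0 : Fin 1 → ℝ) 1 ↔ s ∈ Ioo (-1 : ℝ) 1 := by
  rw [mem_ball_zero_iff, pi_norm_lt_iff one_pos, mem_Ioo, ← abs_lt]
  simp

theorem eq_const_apply_zero (t : Fin 1 → ℝ) : (fun _ => t 0) = t := by
  ext i
  rw [Subsingleton.elim i 0]

theorem mem_openCell_one_iff {e : RelCWComplex.cell (univ : Set X) 1} {x : X} :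
    x ∈ RelCWComplex.openCell 1 e ↔ ∃ s ∈ Ioo (-1 : ℝ) 1, edgeMap e s = x := by
  constructor
  · rintro ⟨t, ht, rfl⟩
    refine ⟨t 0, const_mem_ball_iff.1 ?_, ?_⟩
    · rwa [eq_const_apply_zero]
    · rw [edgeMap, eq_const_apply_zero]
  · rintro ⟨s, hs, rfl⟩
    exact ⟨_, const_mem_ball_iff.2 hs, rfl⟩

theorem edgeMap_mem_openCell (e : RelCWComplex.cell (univ : Set X) 1) {s : ℝ}
    (hs : s ∈ Ioo (-1 : ℝ) 1) : edgeMap e s ∈ RelCWComplex.openCell 1 e :=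
  mem_openCell_one_iff.2 ⟨s, hs, rfl⟩

/-- The parameter of a point of an open `1`-cell. -/
def edgeCoord (e : RelCWComplex.cell (univ : Set X) 1) (x : X) : ℝ :=
  (RelCWComplex.map (C := (univ : Set X)) 1 e).symm x 0

theorem edgeCoord_edgeMap (e : RelCWComplex.cell (univ : Set X) 1) {s : ℝ}
    (hs : s ∈ Ioo (-1 : ℝ) 1) : edgeCoord e (edgeMap e s) = s := by
  rw [edgeCoord, edgeMap, PartialEquiv.left_inv]
  rw [RelCWComplex.source_eq]
  exact const_mem_ball_iff.2 hs

theorem edgeMap_edgeCoord {e : RelCWComplex.cell (univ : Set X) 1} {x : X}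
    (hx : x ∈ RelCWComplex.openCell 1 e) : edgeMap e (edgeCoord e x) = x := by
  obtain ⟨s, hs, rfl⟩ := mem_openCell_one_iff.1 hx
  rw [edgeCoord_edgeMap e hs]

theorem continuousOn_edgeCoord (e : RelCWComplex.cell (univ : Set X) 1) :
    ContinuousOn (edgeCoord e) (RelCWComplex.openCell 1 e) := by
  have h := RelCWComplex.continuousOn_symm (C := (univ : Set X)) 1 e
  rw [← PartialEquiv.image_source_eq_target, RelCWComplex.source_eq] at h
  exact (continuous_apply 0).comp_continuousOn h

theorem continuousOn_edgeMap (e : RelCWComplex.cell (univ : Set X) 1) :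
    ContinuousOn (edgeMap e) (Ioo (-1 : ℝ) 1) :=
  fun _ hs => (continuousAt_edgeMap e hs).continuousWithinAt

theorem edgeMap_eq_edgeMap_iff {e e' : RelCWComplex.cell (univ : Set X) 1} {s s' : ℝ}
    (hs : s ∈ Ioo (-1 : ℝ) 1) (hs' : s' ∈ Ioo (-1 : ℝ) 1) :
    edgeMap e s = edgeMap e' s' ↔ e = e' ∧ s = s' := by
  constructor
  · intro h
    have he : e = e' := by
      by_contra hne
      refine Set.disjoint_left.1 (RelCWComplex.disjoint_openCell_of_ne (i := e) (j := e') ?_)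
        (edgeMap_mem_openCell e hs) (h ▸ edgeMap_mem_openCell e' hs')
      simpa using hne
    subst he
    rw [← edgeCoord_edgeMap e hs, h, edgeCoord_edgeMap e hs']
    exact ⟨rfl, rfl⟩
  · rintro ⟨rfl, rfl⟩
    rfl

theorem disjoint_cellFrontier_openCell (e e' : RelCWComplex.cell (univ : Set X) 1) :
    Disjoint (RelCWComplex.cellFrontier 1 e) (RelCWComplex.openCell 1 e') := by
  obtain ⟨I, hI⟩ := CWComplex.cellFrontier_subset_finite_openCell (C := (univ : Set X)) 1 e
  refine Disjoint.mono_left hI ?_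
  simp only [disjoint_iUnion_left]
  intro m hm j _
  refine RelCWComplex.disjoint_openCell_of_ne fun h => ?_
  exact hm.ne (congrArg Sigma.fst h)

/-- In the absence of cells of dimension `≥ 2`, the edges are open in the complex. -/
theorem isOpen_edgeMap_image [T2Space X]
    (hdim : ∀ m : ℕ, 2 ≤ m → IsEmpty (RelCWComplex.cell (univ : Set X) m))
    (e : RelCWComplex.cell (univ : Set X) 1) {U : Set ℝ} (hU : IsOpen U)
    (hU' : U ⊆ Ioo (-1 : ℝ) 1) : IsOpen (edgeMap e '' U) := by
  have hsub : edgeMap e '' U ⊆ RelCWComplex.openCell 1 e := by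
    rintro _ ⟨s, hs, rfl⟩
    exact edgeMap_mem_openCell e (hU' hs)
  rw [← isClosed_compl_iff]
  refine CWComplex.isClosed_of_isClosed_inter_openCell_or_isClosed_inter_closedCell
    (C := (univ : Set X)) (subset_univ _) fun n hn j => Or.inr ?_
  obtain rfl | hn2 : n = 1 ∨ 2 ≤ n := by omega
  · by_cases hj : j = e
    · subst hj
      have h1 : (edgeMap j '' U)ᶜ ∩ RelCWComplex.closedCell 1 j =
          RelCWComplex.map (C := (univ : Set X)) 1 j ''
            (Metric.closedBall 0 1 \ (fun t : Fin 1 → ℝ => t 0) ⁻¹' U) := by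
        ext x
        constructor
        · rintro ⟨hx, t, ht, rfl⟩
          refine ⟨t, ⟨ht, fun htU => hx ⟨t 0, htU, ?_⟩⟩, rfl⟩
          rw [edgeMap, eq_const_apply_zero]
        · rintro ⟨t, ⟨ht, htU⟩, rfl⟩
          refine ⟨?_, t, ht, rfl⟩
          rintro ⟨s, hs, hst⟩
          rcases (mem_closedBall_zero_iff.1 ht).lt_or_eq with h | h
          · have h2 : t 0 ∈ Ioo (-1 : ℝ) 1 := by
              rw [← const_mem_ball_iff, eq_const_apply_zero]
              exact mem_ball_zero_iff.2 h
            have h3 : edgeMap j s = edgeMap j (t 0) := by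
              rw [hst, edgeMap, eq_const_apply_zero]
            have h4 := ((edgeMap_eq_edgeMap_iff (hU' hs) h2).1 h3).2
            exact htU (show t 0 ∈ U from h4 ▸ hs)
          · refine Set.disjoint_left.1 (disjoint_cellFrontier_openCell j j)
              ⟨t, mem_sphere_zero_iff_norm.2 h, rfl⟩ ?_
            rw [← hst]
            exact edgeMap_mem_openCell j (hU' hs)
      rw [h1]
      refine IsCompact.isClosed ?_
      refine ((isCompact_closedBall _ _).diff (hU.preimage (continuous_apply 0))).image_of_continuousOn
        ((RelCWComplex.continuousOn (C := (univ : Set X)) 1 j).mono sdiff_subset)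
    · have h1 : (edgeMap e '' U)ᶜ ∩ RelCWComplex.closedCell 1 j
          = RelCWComplex.closedCell 1 j := by
        refine inter_eq_right.2 fun x hx hxU => ?_
        rw [← RelCWComplex.cellFrontier_union_openCell_eq_closedCell] at hx
        rcases hx with hx | hx
        · exact Set.disjoint_left.1 (disjoint_cellFrontier_openCell j e) hx (hsub hxU)
        · refine Set.disjoint_left.1 (RelCWComplex.disjoint_openCell_of_ne (i := j) (j := e) ?_) hx
            (hsub hxU)
          simpa using hj
      rw [h1]
      exact RelCWComplex.isClosed_closedCell
  · exact ((hdim n hn2).false j).elim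

theorem isOpen_openCell_one [T2Space X]
    (hdim : ∀ m : ℕ, 2 ≤ m → IsEmpty (RelCWComplex.cell (univ : Set X) m))
    (e : RelCWComplex.cell (univ : Set X) 1) :
    IsOpen (RelCWComplex.openCell 1 e) := by
  have h : RelCWComplex.openCell 1 e = edgeMap e '' Ioo (-1 : ℝ) 1 := by
    ext x
    exact mem_openCell_one_iff
  rw [h]
  exact isOpen_edgeMap_image hdim e isOpen_Ioo subset_rfl

/-! ### Wrapping an arc around the circle -/

/-- A map `θ` from `X` to the unit circle that wraps a small arc through the point `p` of an open
`1`-cell around the circle, and sends the complement of the open set `U ∋ p` to `-1`. -/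
structure IsArcFunction (p : X) (U : Set X) (θ : C(X, ℂ)) : Prop where
  norm_eq_one : ∀ x, ‖θ x‖ = 1
  eq_one_iff : ∀ x, θ x = 1 ↔ x = p
  eq_neg_one : ∀ x ∉ U, θ x = -1
  im_pos : ∀ (e : RelCWComplex.cell (univ : Set X) 1), ∀ s ∈ Ioo (-1 : ℝ) 1, edgeMap e s = p →
    ∀ᶠ r in 𝓝[>] s, 0 < (θ (edgeMap e r)).im
  im_neg : ∀ (e : RelCWComplex.cell (univ : Set X) 1), ∀ s ∈ Ioo (-1 : ℝ) 1, edgeMap e s = p →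
    ∀ᶠ r in 𝓝[<] s, (θ (edgeMap e r)).im < 0

theorem exists_isArcFunction [T2Space X]
    (hdim : ∀ m : ℕ, 2 ≤ m → IsEmpty (RelCWComplex.cell (univ : Set X) m))
    {e : RelCWComplex.cell (univ : Set X) 1} {p : X} (hp : p ∈ RelCWComplex.openCell 1 e)
    {U : Set X} (hU : U ∈ 𝓝 p) : ∃ θ : C(X, ℂ), IsArcFunction p U θ := by
  classical
  obtain ⟨s, hs, rfl⟩ := mem_openCell_one_iff.1 hp
  obtain ⟨ε, hε, hεs⟩ := Metric.nhds_basis_closedBall.mem_iff.1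
    (inter_mem (isOpen_Ioo.mem_nhds hs) ((continuousAt_edgeMap e hs).preimage_mem_nhds hU))
  rw [Real.closedBall_eq_Icc] at hεs
  let t : X → ℝ := fun x => max (-1) (min 1 ((edgeCoord e x - s) / ε))
  have ht1 : ∀ x, t x ≤ 1 := fun x => max_le (by norm_num) (min_le_left _ _)
  have ht2 : ∀ x, -1 ≤ t x := fun x => le_max_left _ _
  let g : ℝ → ℂ := fun r => Complex.exp ((Real.pi * r : ℝ) * Complex.I)
  have hgc : Continuous g := by fun_prop
  have hg1 : g 1 = -1 := by simp [g, Complex.exp_pi_mul_I]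
  have hg2 : g (-1) = -1 := by
    simp [g, Complex.exp_neg, Complex.exp_pi_mul_I]
  let θ : X → ℂ := fun x => if x ∈ RelCWComplex.openCell 1 e then g (t x) else -1
  set K := edgeMap e '' Icc (s - ε) (s + ε) with hK
  have hKclosed : IsClosed K := (isCompact_Icc.image_of_continuousOn
    ((continuousOn_edgeMap e).mono fun r hr => (hεs hr).1)).isClosed
  have hKsub : K ⊆ RelCWComplex.openCell 1 e := by
    rintro _ ⟨r, hr, rfl⟩
    exact edgeMap_mem_openCell e (hεs hr).1
  have hθK : ∀ x ∉ K, θ x = -1 := by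
    intro x hx
    by_cases hxe : x ∈ RelCWComplex.openCell 1 e
    · have h1 : θ x = g (t x) := if_pos hxe
      have h2 : edgeCoord e x ∉ Icc (s - ε) (s + ε) := fun h =>
        hx ⟨_, h, edgeMap_edgeCoord hxe⟩
      rw [mem_Icc, not_and_or, not_le, not_le] at h2
      rw [h1]
      rcases h2 with h2 | h2
      · have h3 : t x = -1 := by
          have : (edgeCoord e x - s) / ε ≤ -1 := by
            rw [div_le_iff₀ hε]
            linarith
          exact max_eq_left ((min_le_right _ _).trans this)
        rw [h3, hg2]
      · have h3 : t x = 1 := by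
          have : 1 ≤ (edgeCoord e x - s) / ε := by
            rw [le_div_iff₀ hε]
            linarith
          change max (-1) (min 1 _) = _
          rw [min_eq_left this, max_eq_right (by norm_num)]
        rw [h3, hg1]
    · exact if_neg hxe
  have hθc : Continuous θ := by
    rw [continuous_iff_continuousAt]
    intro x
    by_cases hxe : x ∈ RelCWComplex.openCell 1 e
    · have ho := (isOpen_openCell_one hdim e).mem_nhds hxe
      have h1 : ContinuousAt (fun x => g (t x)) x := by
        have h2 := (continuousOn_edgeCoord e).continuousAt ho
        have h3 : ContinuousAt t x := by fun_prop
        exact hgc.continuousAt.comp h3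
      refine h1.congr ?_
      filter_upwards [ho] with y hy
      exact (if_pos hy).symm
    · have ho := hKclosed.isOpen_compl.mem_nhds fun h => hxe (hKsub h)
      refine (continuousAt_const (y := (-1 : ℂ))).congr ?_
      filter_upwards [ho] with y hy
      exact (hθK y hy).symm
  have hθe : ∀ r ∈ Icc (s - ε) (s + ε), θ (edgeMap e r) = g ((r - s) / ε) := by
    intro r hr
    have h1 : θ (edgeMap e r) = g (t (edgeMap e r)) :=
      if_pos (edgeMap_mem_openCell e (hεs hr).1)
    have h2 : (r - s) / ε ≤ 1 := by
      rw [div_le_iff₀ hε]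
      linarith [hr.2]
    have h3 : -1 ≤ (r - s) / ε := by
      rw [le_div_iff₀ hε]
      linarith [hr.1]
    rw [h1]
    change g (max (-1) (min 1 ((edgeCoord e (edgeMap e r) - s) / ε))) = _
    rw [edgeCoord_edgeMap e (hεs hr).1, min_eq_right h2, max_eq_right h3]
  have hgre : ∀ r, (g r).re = Real.cos (Real.pi * r) := fun r => Complex.exp_ofReal_mul_I_re _
  have hgim : ∀ r, (g r).im = Real.sin (Real.pi * r) := fun r => Complex.exp_ofReal_mul_I_im _
  refine ⟨⟨θ, hθc⟩, ⟨?_, ?_, ?_, ?_, ?_⟩⟩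
  · intro x
    change ‖θ x‖ = 1
    by_cases hxe : x ∈ RelCWComplex.openCell 1 e
    · have h1 : θ x = g (t x) := if_pos hxe
      rw [h1]
      exact Complex.norm_exp_ofReal_mul_I _
    · have h1 : θ x = -1 := if_neg hxe
      rw [h1]
      simp
  · intro x
    change θ x = 1 ↔ _
    constructor
    · intro hx
      have hxK : x ∈ K := by
        by_contra h
        rw [hθK x h] at hx
        norm_num at hx
      obtain ⟨r, hr, rfl⟩ := hxK
      rw [hθe r hr] at hx
      have h1 := hgre ((r - s) / ε)
      rw [hx, Complex.one_re] at h1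
      have h2 : |(r - s) / ε| ≤ 1 := by
        rw [abs_div, abs_of_pos hε, div_le_one hε, abs_le]
        constructor <;> linarith [hr.1, hr.2]
      have h2' := abs_le.1 h2
      have h3 := (Real.cos_eq_one_iff_of_lt_of_lt
        (by nlinarith [Real.pi_pos]) (by nlinarith [Real.pi_pos])).1 h1.symm
      have h4 : r - s = 0 := by
        have := mul_eq_zero.1 h3
        have := this.resolve_left Real.pi_ne_zero
        exact (div_eq_zero_iff.1 this).resolve_right hε.ne'
      rw [sub_eq_zero.1 h4]
    · rintro rfl
      rw [hθe s ⟨by linarith, by linarith⟩]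
      simp [g]
  · intro x hx
    refine hθK x fun h => hx ?_
    obtain ⟨r, hr, rfl⟩ := h
    exact (hεs hr).2
  · intro e' s' hs' h
    obtain ⟨rfl, rfl⟩ := (edgeMap_eq_edgeMap_iff hs' hs).1 h
    filter_upwards [Ioo_mem_nhdsGT (show s' < s' + ε by linarith)] with r hr
    change 0 < (θ (edgeMap e' r)).im
    rw [hθe r ⟨by linarith [hr.1], hr.2.le⟩, hgim]
    have h1 : 0 < (r - s') / ε := div_pos (by linarith [hr.1]) hε
    have h2 : (r - s') / ε < 1 := by
      rw [div_lt_one hε]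
      linarith [hr.2]
    exact Real.sin_pos_of_pos_of_lt_pi (by positivity) (by nlinarith [Real.pi_pos])
  · intro e' s' hs' h
    obtain ⟨rfl, rfl⟩ := (edgeMap_eq_edgeMap_iff hs' hs).1 h
    filter_upwards [Ioo_mem_nhdsLT (show s' - ε < s' by linarith)] with r hr
    change (θ (edgeMap e' r)).im < 0
    rw [hθe r ⟨hr.1.le, by linarith [hr.2]⟩, hgim]
    have h1 : (r - s') / ε < 0 := div_neg_of_neg_of_pos (by linarith [hr.2]) hε
    have h2 : -1 < (r - s') / ε := by
      rw [lt_div_iff₀ hε]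
      linarith [hr.1]
    exact Real.sin_neg_of_neg_of_neg_pi_lt (by nlinarith [Real.pi_pos])
      (by nlinarith [Real.pi_pos])

end Edge

/-! ### The topology of the gapped space -/

section GapTopology

variable {X : Type*} {P : Set X}

/-- The inclusion of `X \ P` into the gapped space, extended to all of `X`; the value at `p ∈ P`
is the arbitrary choice of the endpoint `(p, true)`. -/
def toGap (P : Set X) (x : X) : GapSpace P := by
  classical
  exact if h : x ∈ P then GapSpace.endpoint ⟨x, h⟩ true else GapSpace.old x h

theorem toGap_of_notMem {x : X} (hx : x ∉ P) : toGap P x = GapSpace.old x hx := dif_neg hx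

theorem GapSpace.cases (z : GapSpace P) :
    (∃ x, ∃ hx : x ∉ P, z = GapSpace.old x hx) ∨ ∃ p b, z = GapSpace.endpoint p b := by
  rcases z with ⟨x, hx⟩ | ⟨p, b⟩
  · exact Or.inl ⟨x, hx, rfl⟩
  · exact Or.inr ⟨p, b, rfl⟩

variable [TopologicalSpace X]

/-- The function on the gapped space that is `jump ∘ θ` away from `p`, and takes the values `0`
and `1` at the two endpoints at `p`. -/
def gapJump (P : Set X) (θ : C(X, ℂ)) (p : X) : GapSpace P → ℂ := by
  classical
  exact Sum.elim (fun x => jump (θ x.1))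
    (fun q => if q.1.1 = p then (if q.2 then 1 else 0) else jump (θ q.1.1))

theorem gapJump_old (θ : C(X, ℂ)) (p : X) {x : X} (hx : x ∉ P) :
    gapJump P θ p (GapSpace.old x hx) = jump (θ x) := rfl

theorem gapJump_endpoint_self (θ : C(X, ℂ)) (p : P) (b : Bool) :
    gapJump P θ p (GapSpace.endpoint p b) = if b then 1 else 0 := if_pos rfl

theorem gapJump_endpoint_of_ne (θ : C(X, ℂ)) {p : X} {q : P} (b : Bool) (h : (q : X) ≠ p) :
    gapJump P θ p (GapSpace.endpoint q b) = jump (θ q) := if_neg h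

theorem star_gapJump (θ : C(X, ℂ)) (p : X) (z : GapSpace P) :
    star (gapJump P θ p z) = gapJump P θ p z := by
  obtain ⟨y, hy, rfl⟩ | ⟨q, b, rfl⟩ := z.cases
  · exact star_jump _
  · by_cases h : (q : X) = p
    · subst h
      rw [gapJump_endpoint_self]
      cases b <;> simp
    · rw [gapJump_endpoint_of_ne θ b h]
      exact star_jump _

variable [CWComplex (univ : Set X)]

theorem collapse_toGap (x : X) : collapse P (toGap P x) = x := by
  by_cases h : x ∈ P
  · rw [toGap, dif_pos h]
    rfl
  · rw [toGap_of_notMem h]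
    rfl

theorem collapse_surjective : Function.Surjective (collapse P) := fun x => ⟨_, collapse_toGap x⟩

theorem collapse_old {x : X} (hx : x ∉ P) : collapse P (GapSpace.old x hx) = x := rfl

theorem collapse_endpoint (p : P) (b : Bool) : collapse P (GapSpace.endpoint p b) = p := rfl

theorem isOpen_gapSpace_iff {U : Set (GapSpace P)} :
    IsOpen U ↔ IsOpen {x : {x : X // x ∉ P} | GapSpace.old x.1 x.2 ∈ U} ∧
      ∀ (p : P) (b : Bool), GapSpace.endpoint p b ∈ U →
        ∀ (e : RelCWComplex.cell (univ : Set X) 1), ∀ s ∈ Ioo (-1 : ℝ) 1, edgeMap e s = p →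
          ∀ᶠ r in sideFilter b s, ∀ h : edgeMap e r ∉ P, GapSpace.old (edgeMap e r) h ∈ U :=
  Iff.rfl

theorem sideFilter_le_nhdsNE (b : Bool) (s : ℝ) : sideFilter b s ≤ 𝓝[≠] s := by
  cases b
  · exact nhdsLT_le_nhdsNE s
  · exact nhdsGT_le_nhdsNE s

instance sideFilter_neBot (b : Bool) (s : ℝ) : (sideFilter b s).NeBot := by
  cases b
  · exact inferInstanceAs (𝓝[<] s).NeBot
  · exact inferInstanceAs (𝓝[>] s).NeBot

theorem eventually_edgeMap_notMem [T1Space X] (hP : P.Finite)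
    (e : RelCWComplex.cell (univ : Set X) 1) {s : ℝ} (hs : s ∈ Ioo (-1 : ℝ) 1) :
    ∀ᶠ r in 𝓝[≠] s, edgeMap e r ∉ P := by
  have h1 : IsOpen (P \ {edgeMap e s})ᶜ := (hP.subset sdiff_subset).isClosed.isOpen_compl
  have h2 : ∀ᶠ r in 𝓝 s, edgeMap e r ∉ P \ {edgeMap e s} :=
    (continuousAt_edgeMap e hs).eventually (h1.mem_nhds (by simp))
  filter_upwards [nhdsWithin_le_nhds h2, nhdsWithin_le_nhds (isOpen_Ioo.mem_nhds hs),
    self_mem_nhdsWithin] with r h3 h4 h5 h6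
  refine h3 ⟨h6, fun h7 => h5 ?_⟩
  exact ((edgeMap_eq_edgeMap_iff h4 hs).1 h7).2

theorem continuous_old : Continuous fun x : {x : X // x ∉ P} => GapSpace.old x.1 x.2 :=
  continuous_def.2 fun _ hU => (isOpen_gapSpace_iff.1 hU).1

/-- The edge on the side `b` of `p` tends to the endpoint `(p, b)`. -/
theorem tendsto_toGap_edgeMap [T1Space X] (hP : P.Finite) (p : P) (b : Bool)
    {e : RelCWComplex.cell (univ : Set X) 1} {s : ℝ} (hs : s ∈ Ioo (-1 : ℝ) 1)
    (hp : edgeMap e s = p) :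
    Tendsto (fun r => toGap P (edgeMap e r)) (sideFilter b s) (𝓝 (GapSpace.endpoint p b)) := by
  rw [tendsto_nhds]
  intro U hU hpU
  filter_upwards [(isOpen_gapSpace_iff.1 hU).2 p b hpU e s hs hp,
    sideFilter_le_nhdsNE b s (eventually_edgeMap_notMem hP e hs)] with r h1 h2
  rw [mem_preimage, toGap_of_notMem h2]
  exact h1 h2

theorem continuous_gapSpace {Y : Type*} [TopologicalSpace Y] {F : GapSpace P → Y}
    (h1 : Continuous fun x : {x : X // x ∉ P} => F (GapSpace.old x.1 x.2))
    (h2 : ∀ (p : P) (b : Bool) (e : RelCWComplex.cell (univ : Set X) 1), ∀ s ∈ Ioo (-1 : ℝ) 1,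
      edgeMap e s = p →
      Tendsto (fun r => F (toGap P (edgeMap e r))) (sideFilter b s)
        (𝓝 (F (GapSpace.endpoint p b)))) : Continuous F := by
  refine continuous_def.2 fun V hV => isOpen_gapSpace_iff.2 ⟨hV.preimage h1, ?_⟩
  intro p b hp e s hs hes
  filter_upwards [(h2 p b e s hs hes).eventually (hV.mem_nhds hp)] with r hr h
  rw [toGap_of_notMem h] at hr
  exact hr

theorem comap_collapse_nhds_le_of_notMem (hP : IsClosed P) {x : X} (hx : x ∉ P) :
    comap (collapse P) (𝓝 x) ≤ 𝓝 (GapSpace.old x hx) := by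
  intro U hU
  obtain ⟨V, hVU, hV, hxV⟩ := mem_nhds_iff.1 hU
  have h1 := (isOpen_gapSpace_iff.1 hV).1
  have h2 := (hP.isOpen_compl.isOpenMap_subtype_val _ h1).mem_nhds ⟨⟨x, hx⟩, hxV, rfl⟩
  refine ⟨_, h2, ?_⟩
  rintro z ⟨y, hy, hyz⟩
  obtain ⟨y', hy', rfl⟩ | ⟨p, b, rfl⟩ := z.cases
  · have h3 : y.1 = y' := hyz
    subst h3
    exact hVU hy
  · rw [collapse_endpoint] at hyz
    exact absurd (hyz ▸ p.2) y.2

theorem comap_collapse_nhds_le_of_mem [T2Space X]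
    (hdim : ∀ m : ℕ, 2 ≤ m → IsEmpty (RelCWComplex.cell (univ : Set X) m)) (hP : P.Finite)
    (p : P) {e : RelCWComplex.cell (univ : Set X) 1} (he : (p : X) ∈ RelCWComplex.openCell 1 e) :
    comap (collapse P) (𝓝 (p : X)) ≤
      𝓝 (GapSpace.endpoint p false) ⊔ 𝓝 (GapSpace.endpoint p true) := by
  obtain ⟨s, hs, hes⟩ := mem_openCell_one_iff.1 he
  intro U hU
  rw [mem_sup] at hU
  have h1 : ∀ᶠ r in 𝓝[≠] s, toGap P (edgeMap e r) ∈ U := by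
    rw [← nhdsLT_sup_nhdsGT]
    exact mem_sup.2 ⟨tendsto_toGap_edgeMap hP p false hs hes hU.1,
      tendsto_toGap_edgeMap hP p true hs hes hU.2⟩
  have h2 : ∀ᶠ r in 𝓝 s, r ≠ s → toGap P (edgeMap e r) ∈ U ∧ edgeMap e r ∉ P := by
    exact eventually_nhdsWithin_iff.1 (h1.and (eventually_edgeMap_notMem hP e hs))
  obtain ⟨V, hV, hVo, hsV⟩ := mem_nhds_iff.1 (h2.and (isOpen_Ioo.mem_nhds hs))
  have h3 : IsOpen (edgeMap e '' V) := isOpen_edgeMap_image hdim e hVo fun r hr => (hV hr).2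
  refine ⟨_, h3.mem_nhds ⟨s, hsV, hes⟩, ?_⟩
  rintro z ⟨r, hr, hrz⟩
  obtain ⟨y, hy, rfl⟩ | ⟨q, b, rfl⟩ := z.cases
  · rw [collapse_old] at hrz
    subst hrz
    have hrs : r ≠ s := by
      rintro rfl
      exact hy (hes ▸ p.2)
    have h4 := ((hV hr).1 hrs).1
    rwa [toGap_of_notMem hy] at h4
  · rw [collapse_endpoint] at hrz
    have hrs : r = s := by
      by_contra h
      exact ((hV hr).1 h).2 (hrz ▸ q.2)
    have hqp : q = p := Subtype.ext (by rw [← hrz, hrs, hes])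
    rw [hqp]
    cases b
    · exact mem_of_mem_nhds hU.1
    · exact mem_of_mem_nhds hU.2

theorem compactSpace_gapSpace [T2Space X] [CompactSpace X]
    (hdim : ∀ m : ℕ, 2 ≤ m → IsEmpty (RelCWComplex.cell (univ : Set X) m)) (hP : P.Finite)
    (hPe : ∀ p ∈ P, ∃ e : RelCWComplex.cell (univ : Set X) 1, p ∈ RelCWComplex.openCell 1 e) :
    CompactSpace (GapSpace P) := by
  refine ⟨isCompact_iff_ultrafilter_le_nhds.2 fun f _ => ?_⟩
  obtain ⟨x, -, hx⟩ := isCompact_iff_ultrafilter_le_nhds.1 (isCompact_univ (X := X))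
    (f.map (collapse P)) (by simp)
  have h1 : (f : Filter (GapSpace P)) ≤ comap (collapse P) (𝓝 x) := map_le_iff_le_comap.1 hx
  by_cases hxP : x ∈ P
  · obtain ⟨e, he⟩ := hPe x hxP
    have h2 := h1.trans (comap_collapse_nhds_le_of_mem hdim hP ⟨x, hxP⟩ he)
    rcases Ultrafilter.le_sup_iff.1 h2 with h3 | h3
    · exact ⟨_, mem_univ _, h3⟩
    · exact ⟨_, mem_univ _, h3⟩
  · exact ⟨_, mem_univ _, h1.trans (comap_collapse_nhds_le_of_notMem hP.isClosed hxP)⟩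

theorem dense_range_old [T1Space X] (hP : P.Finite)
    (hPe : ∀ p ∈ P, ∃ e : RelCWComplex.cell (univ : Set X) 1, p ∈ RelCWComplex.openCell 1 e) :
    DenseRange fun x : {x : X // x ∉ P} => GapSpace.old x.1 x.2 := by
  intro z
  obtain ⟨y, hy, rfl⟩ | ⟨p, b, rfl⟩ := z.cases
  · exact subset_closure ⟨⟨y, hy⟩, rfl⟩
  · obtain ⟨e, he⟩ := hPe p p.2
    obtain ⟨s, hs, hes⟩ := mem_openCell_one_iff.1 he
    refine mem_closure_of_tendsto (tendsto_toGap_edgeMap hP p b hs hes) ?_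
    filter_upwards [sideFilter_le_nhdsNE b s (eventually_edgeMap_notMem hP e hs)] with r hr
    exact ⟨⟨_, hr⟩, (toGap_of_notMem hr).symm⟩

/-! ### Functions on the gapped space with a single jump -/

theorem continuous_gapJump [T1Space X] (hP : P.Finite) {θ : C(X, ℂ)} {p : P} {U : Set X}
    (hθ : IsArcFunction (p : X) U θ) : Continuous (gapJump P θ p) := by
  refine continuous_gapSpace ?_ ?_
  · refine continuous_iff_continuousAt.2 fun x => ?_
    have h1 : θ x.1 ≠ 1 := fun h => x.2 ((hθ.eq_one_iff _).1 h ▸ p.2)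
    exact ContinuousAt.comp (f := fun x : {x : X // x ∉ P} => θ x.1)
      (continuousAt_jump (hθ.norm_eq_one _) h1) (by fun_prop)
  · intro q b e s hs hes
    have hev : ∀ᶠ r in sideFilter b s, gapJump P θ p (toGap P (edgeMap e r))
        = jump (θ (edgeMap e r)) := by
      filter_upwards [sideFilter_le_nhdsNE b s (eventually_edgeMap_notMem hP e hs)] with r hr
      rw [toGap_of_notMem hr, gapJump_old]
    refine Tendsto.congr' (hev.mono fun _ h => h.symm) ?_
    have hθs : Tendsto (fun r => θ (edgeMap e r)) (sideFilter b s) (𝓝 (θ q)) := by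
      rw [← hes]
      exact (θ.continuous.continuousAt.comp (continuousAt_edgeMap e hs)).tendsto.mono_left
        ((sideFilter_le_nhdsNE b s).trans nhdsWithin_le_nhds)
    by_cases hqp : q = p
    · subst hqp
      rw [gapJump_endpoint_self]
      rw [(hθ.eq_one_iff _).2 rfl] at hθs
      cases b
      · refine (tendsto_const_nhds (x := (0 : ℂ))).congr' ?_
        filter_upwards [hθ.im_neg e s hs hes] with r hr
        exact (jump_of_im_nonpos hr.le).symm
      · have h2 : Tendsto (fun r => ((max (θ (edgeMap e r)).re 0 : ℝ) : ℂ)) (sideFilter true s)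
            (𝓝 1) := by
          have h3 : Continuous fun z : ℂ => ((max z.re 0 : ℝ) : ℂ) := by fun_prop
          have h4 := (h3.tendsto 1).comp hθs
          simpa [Function.comp_def] using h4
        refine h2.congr' ?_
        filter_upwards [hθ.im_pos e s hs hes] with r hr
        exact (jump_of_im_pos hr).symm
    · have hne : (q : X) ≠ p := fun h => hqp (Subtype.ext h)
      rw [gapJump_endpoint_of_ne θ b hne]
      exact (continuousAt_jump (hθ.norm_eq_one _)
        fun h => hne ((hθ.eq_one_iff _).1 h)).tendsto.comp hθs

theorem t2Space_gapSpace [T2Space X]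
    (hdim : ∀ m : ℕ, 2 ≤ m → IsEmpty (RelCWComplex.cell (univ : Set X) m)) (hP : P.Finite)
    (hPe : ∀ p ∈ P, ∃ e : RelCWComplex.cell (univ : Set X) 1, p ∈ RelCWComplex.openCell 1 e) :
    T2Space (GapSpace P) := by
  refine ⟨fun z z' hne => ?_⟩
  by_cases hc : collapse P z = collapse P z'
  · obtain ⟨y, hy, rfl⟩ | ⟨p, b, rfl⟩ := z.cases <;>
      obtain ⟨y', hy', rfl⟩ | ⟨p', b', rfl⟩ := z'.cases
    · rw [collapse_old, collapse_old] at hc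
      subst hc
      exact absurd rfl hne
    · rw [collapse_old, collapse_endpoint] at hc
      exact absurd (hc ▸ p'.2) hy
    · rw [collapse_old, collapse_endpoint] at hc
      exact absurd (hc ▸ p.2) hy'
    · rw [collapse_endpoint, collapse_endpoint] at hc
      obtain rfl : p = p' := Subtype.ext hc
      obtain ⟨e, he⟩ := hPe p p.2
      obtain ⟨θ, hθ⟩ := exists_isArcFunction hdim he univ_mem
      refine separated_by_continuous (continuous_gapJump hP hθ) ?_
      rw [gapJump_endpoint_self, gapJump_endpoint_self]
      cases b <;> cases b' <;> simp at hne ⊢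
  · exact separated_by_continuous (collapse P).continuous hc

/-! ### The reflection of the gapped space -/

theorem forall_lt_or_forall_gt_of_ne {S : Set ℝ} (hS : IsPreconnected S) {f : ℝ → ℝ}
    (hf : ContinuousOn f S) {c : ℝ} (hc : ∀ x ∈ S, f x ≠ c) :
    (∀ x ∈ S, f x < c) ∨ ∀ x ∈ S, c < f x := by
  by_contra! h
  obtain ⟨⟨x, hx, hxc⟩, y, hy, hyc⟩ := h
  obtain ⟨z, hz, hzc⟩ := hS.intermediate_value hy hx hf ⟨hyc, hxc⟩
  exact hc z hz hzc

/-- A homeomorphism carries each side of `p` to one of the sides of its image. -/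
theorem exists_side [T2Space X]
    (hdim : ∀ m : ℕ, 2 ≤ m → IsEmpty (RelCWComplex.cell (univ : Set X) m)) (hP : P.Finite)
    (hPe : ∀ p ∈ P, ∃ e : RelCWComplex.cell (univ : Set X) 1, p ∈ RelCWComplex.openCell 1 e)
    (τ : X ≃ₜ X) (hτP : ∀ p ∈ P, τ p ∈ P) (p : P) (b : Bool) :
    ∃ b' : Bool, ∀ (e : RelCWComplex.cell (univ : Set X) 1), ∀ s ∈ Ioo (-1 : ℝ) 1, edgeMap e s = p →
      Tendsto (fun r => toGap P (τ (edgeMap e r))) (sideFilter b s)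
        (𝓝 (GapSpace.endpoint ⟨τ p, hτP p p.2⟩ b')) := by
  obtain ⟨e, he⟩ := hPe p p.2
  obtain ⟨s, hs, hes⟩ := mem_openCell_one_iff.1 he
  obtain ⟨e', he'⟩ := hPe (τ p) (hτP p p.2)
  obtain ⟨s', hs', hes'⟩ := mem_openCell_one_iff.1 he'
  have hτc : ContinuousAt (fun r => τ (edgeMap e r)) s :=
    τ.continuous.continuousAt.comp (continuousAt_edgeMap e hs)
  have hnear : ∀ᶠ r in 𝓝 s, r ∈ Ioo (-1 : ℝ) 1 ∧ τ (edgeMap e r) ∈ RelCWComplex.openCell 1 e' := by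
    refine Eventually.and (isOpen_Ioo.mem_nhds hs) ?_
    refine hτc.eventually ((isOpen_openCell_one hdim e').mem_nhds ?_)
    change τ (edgeMap e s) ∈ _
    rwa [hes]
  obtain ⟨δ, hδ, hδ'⟩ := Metric.eventually_nhds_iff_ball.1 hnear
  rw [Real.ball_eq_Ioo] at hδ'
  let ρ : ℝ → ℝ := fun r => edgeCoord e' (τ (edgeMap e r))
  have hρ : ∀ r ∈ Ioo (s - δ) (s + δ), edgeMap e' (ρ r) = τ (edgeMap e r) := fun r hr =>
    edgeMap_edgeCoord (hδ' r hr).2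
  have hρs : ρ s = s' := by
    change edgeCoord e' (τ (edgeMap e s)) = s'
    rw [hes, ← hes', edgeCoord_edgeMap e' hs']
  have hρc : ContinuousOn ρ (Ioo (s - δ) (s + δ)) :=
    (continuousOn_edgeCoord e').comp (τ.continuous.comp_continuousOn
      ((continuousOn_edgeMap e).mono fun r hr => (hδ' r hr).1)) fun r hr => (hδ' r hr).2
  have hρne : ∀ r ∈ Ioo (s - δ) (s + δ), r ≠ s → ρ r ≠ s' := by
    intro r hr hrs h
    have h1 := hρ r hr
    rw [h, hes', ← hes] at h1
    exact hrs ((edgeMap_eq_edgeMap_iff (hδ' r hr).1 hs).1 (τ.injective h1.symm)).2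
  -- the open interval on the side `b` of `s`, where `ρ - s'` has constant sign
  obtain ⟨S, hSpre, hSsub, hSne, hSmem⟩ : ∃ S : Set ℝ, IsPreconnected S ∧
      S ⊆ Ioo (s - δ) (s + δ) ∧ s ∉ S ∧ S ∈ sideFilter b s := by
    cases b
    · exact ⟨Ioo (s - δ) s, isPreconnected_Ioo, Ioo_subset_Ioo_right (by linarith), by simp,
        Ioo_mem_nhdsLT (by linarith)⟩
    · exact ⟨Ioo s (s + δ), isPreconnected_Ioo, Ioo_subset_Ioo_left (by linarith), by simp,
        Ioo_mem_nhdsGT (by linarith)⟩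
  have hlim : Tendsto ρ (sideFilter b s) (𝓝 s') := by
    have h1 : ContinuousAt ρ s := hρc.continuousAt (Ioo_mem_nhds (by linarith) (by linarith))
    have h2 := h1.tendsto
    rw [hρs] at h2
    exact h2.mono_left ((sideFilter_le_nhdsNE b s).trans nhdsWithin_le_nhds)
  obtain ⟨b', hb'⟩ : ∃ b', Tendsto ρ (sideFilter b s) (sideFilter b' s') := by
    rcases forall_lt_or_forall_gt_of_ne hSpre (hρc.mono hSsub)
      (fun r hr => hρne r (hSsub hr) fun h => hSne (h ▸ hr)) with h | h
    · exact ⟨false, tendsto_nhdsWithin_iff.2 ⟨hlim, mem_of_superset hSmem h⟩⟩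
    · exact ⟨true, tendsto_nhdsWithin_iff.2 ⟨hlim, mem_of_superset hSmem h⟩⟩
  refine ⟨b', fun e₁ s₁ hs₁ hes₁ => ?_⟩
  obtain ⟨rfl, rfl⟩ := (edgeMap_eq_edgeMap_iff hs₁ hs).1 (hes₁.trans hes.symm)
  refine ((tendsto_toGap_edgeMap hP ⟨τ p, hτP p p.2⟩ b' hs' hes').comp hb').congr' ?_
  filter_upwards [hSmem] with r hr
  rw [Function.comp_apply, hρ r (hSsub hr)]

/-- Continuous self-maps of the gapped space that cover the same map of `X` under `collapse`
coincide, provided this map preserves the complement of `P`. -/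
theorem eq_of_collapse_eq [T2Space X] [T2Space (GapSpace P)] (hP : P.Finite)
    (hPe : ∀ p ∈ P, ∃ e : RelCWComplex.cell (univ : Set X) 1, p ∈ RelCWComplex.openCell 1 e)
    {t : X → X} (ht : ∀ x ∉ P, t x ∉ P) {f g : GapSpace P → GapSpace P} (hf : Continuous f)
    (hg : Continuous g) (hft : ∀ z, collapse P (f z) = t (collapse P z))
    (hgt : ∀ z, collapse P (g z) = t (collapse P z)) : f = g := by
  have hinj : ∀ (z z' : GapSpace P), collapse P z ∉ P → collapse P z = collapse P z' → z = z' := by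
    intro z z' hz h
    obtain ⟨y, hy, rfl⟩ | ⟨p, b, rfl⟩ := z.cases
    · obtain ⟨y', hy', rfl⟩ | ⟨p', b', rfl⟩ := z'.cases
      · rw [collapse_old, collapse_old] at h
        subst h
        rfl
      · rw [collapse_old, collapse_endpoint] at h
        exact absurd (h ▸ p'.2) hy
    · exact absurd p.2 hz
  refine (dense_range_old hP hPe).equalizer hf hg (funext fun x => hinj _ _ ?_ ?_)
  · change collapse P (f (GapSpace.old x.1 x.2)) ∉ P
    rw [hft]
    exact ht _ x.2
  · exact (hft _).trans (hgt _).symm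

theorem exists_gap_reflection [T2Space X]
    (hdim : ∀ m : ℕ, 2 ≤ m → IsEmpty (RelCWComplex.cell (univ : Set X) m)) (hP : P.Finite)
    (hPe : ∀ p ∈ P, ∃ e : RelCWComplex.cell (univ : Set X) 1, p ∈ RelCWComplex.openCell 1 e)
    (τ : X ≃ₜ X) (hτ : Function.Involutive τ) (hτP : ∀ p ∈ P, τ p ∈ P) :
    ∃ σ : GapSpace P ≃ₜ GapSpace P, Function.Involutive σ ∧
      ∀ z, collapse P (σ z) = τ (collapse P z) := by
  have hT2 := t2Space_gapSpace hdim hP hPe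
  have hτP' : ∀ x ∉ P, τ x ∉ P := fun x hx h => hx (hτ x ▸ hτP _ h)
  choose flip hflip using exists_side hdim hP hPe τ hτP
  let f : GapSpace P → GapSpace P := Sum.elim (fun x => GapSpace.old (τ x.1) (hτP' _ x.2))
    (fun q => GapSpace.endpoint ⟨τ q.1, hτP _ q.1.2⟩ (flip q.1 q.2))
  have hfold : ∀ (x : X) (hx : x ∉ P), f (GapSpace.old x hx) = GapSpace.old (τ x) (hτP' _ hx) :=
    fun _ _ => rfl
  have hf : Continuous f := by
    refine continuous_gapSpace ?_ ?_
    · exact continuous_old.comp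
        ((τ.continuous.comp continuous_subtype_val).subtype_mk fun x => hτP' _ x.2)
    · intro p b e s hs hes
      refine (hflip p b e s hs hes).congr' ?_
      filter_upwards [sideFilter_le_nhdsNE b s (eventually_edgeMap_notMem hP e hs)] with r hr
      rw [toGap_of_notMem hr, hfold, toGap_of_notMem]
  have hcf : ∀ z, collapse P (f z) = τ (collapse P z) := by
    intro z
    obtain ⟨y, hy, rfl⟩ | ⟨p, b, rfl⟩ := z.cases
    · rfl
    · rfl
  have hinv : Function.Involutive f := by
    have h := eq_of_collapse_eq hP hPe (t := id) (f := f ∘ f) (g := id) (fun _ h => h)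
      (hf.comp hf) continuous_id
      (fun z => by rw [Function.comp_apply, hcf, hcf, hτ, id_eq]) (fun z => rfl)
    exact fun z => congrFun h z
  exact ⟨⟨hinv.toPerm f, hf, hf⟩, hinv, hcf⟩

end GapTopology

/-! ### Extending a homomorphism along finitely many jumps -/

section Extension

/-- A description of `C(Y)` as the algebra generated by `C(X)` and finitely many elements `h j`,
for a quotient map `q : Y → X` that glues finitely many pairs `z j false`, `z j true` of points to
points `pt j`: the function `h j` separates the two points of the pair with index `j`, and is
localized near this pair, by means of the functions `k j` on `X`. -/
structure JumpSystem {X Y : Type*} [TopologicalSpace X] [TopologicalSpace Y] (q : C(Y, X))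
    (J : Type*) where
  pt : J → X
  z : J → Bool → Y
  h : J → C(Y, ℂ)
  k : J → C(X, ℂ)
  surjective : Function.Surjective q
  q_z : ∀ j b, q (z j b) = pt j
  exists_factor : ∀ F : C(Y, ℂ), (∀ j, F (z j true) = F (z j false)) →
    ∃ f : C(X, ℂ), f.comp q = F
  h_true : ∀ j, h j (z j true) = 1
  h_false : ∀ j, h j (z j false) = 0
  star_h : ∀ j, star (h j) = h j
  k_pt : ∀ j, k j (pt j) = 1
  k_mul_h : ∀ j, (k j).comp q * h j = h j
  k_mul_k : ∀ i j, i ≠ j → k i * k j = 0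

variable {X Y : Type*} [TopologicalSpace X] [TopologicalSpace Y] {q : C(Y, X)} {J : Type*}

namespace JumpSystem

theorem comp_injective (S : JumpSystem q J) {f g : C(X, ℂ)} (hfg : f.comp q = g.comp q) : f = g := by
  ext x
  obtain ⟨y, rfl⟩ := S.surjective x
  exact DFunLike.congr_fun hfg y

variable (S : JumpSystem q J)

theorem h_mul_h {i j : J} (hij : i ≠ j) : S.h i * S.h j = 0 := by
  have h1 : (S.k i).comp q * (S.k j).comp q = 0 := congrArg (fun f => f.comp q) (S.k_mul_k i j hij)
  rw [← S.k_mul_h i, ← S.k_mul_h j, mul_mul_mul_comm, h1, zero_mul]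

theorem h_z_of_ne {i j : J} (hij : i ≠ j) (b : Bool) : S.h j (S.z i b) = 0 := by
  have h1 : S.k j (S.pt i) * S.k i (S.pt i) = 0 :=
    DFunLike.congr_fun (S.k_mul_k j i hij.symm) (S.pt i)
  rw [S.k_pt, mul_one] at h1
  have h2 : S.k j (q (S.z i b)) * S.h j (S.z i b) = S.h j (S.z i b) :=
    DFunLike.congr_fun (S.k_mul_h j) (S.z i b)
  rw [← h2, S.q_z, h1, zero_mul]

theorem exists_comp_eq_sq_sub (j : J) :
    ∃ m : C(X, ℂ), m.comp q = S.h j * S.h j - S.h j := by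
  refine S.exists_factor _ fun i => ?_
  by_cases hij : i = j
  · subst hij
    simp [S.h_true, S.h_false]
  · simp [S.h_z_of_ne hij]

theorem exists_comp_eq_mul_sub (j : J) (f : C(X, ℂ)) :
    ∃ g : C(X, ℂ), g.comp q = f.comp q * S.h j - f (S.pt j) • S.h j := by
  refine S.exists_factor _ fun i => ?_
  by_cases hij : i = j
  · subst hij
    simp [S.h_true, S.h_false, S.q_z]
  · simp [S.h_z_of_ne hij]

variable [Fintype J]

/-- The jump of a function on `Y` at the pair with index `j`. -/
def jumpAt (F : C(Y, ℂ)) (j : J) : ℂ := F (S.z j true) - F (S.z j false)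

theorem jumpAt_comp_add (f : C(X, ℂ)) (c : J → ℂ) (j : J) :
    S.jumpAt (f.comp q + ∑ i, c i • S.h i) j = c j := by
  classical
  have h1 : ∀ b, (∑ i, c i • S.h i) (S.z j b) = c j * S.h j (S.z j b) := by
    intro b
    rw [ContinuousMap.sum_apply, Finset.sum_eq_single j]
    · rfl
    · intro i _ hij
      rw [ContinuousMap.smul_apply, S.h_z_of_ne hij.symm, smul_zero]
    · simp
  rw [jumpAt, ContinuousMap.add_apply, ContinuousMap.add_apply, h1, h1, S.h_true, S.h_false,
    ContinuousMap.comp_apply, ContinuousMap.comp_apply, S.q_z, S.q_z]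
  ring

theorem exists_decomposition (F : C(Y, ℂ)) :
    ∃ f : C(X, ℂ), F = f.comp q + ∑ j, S.jumpAt F j • S.h j := by
  obtain ⟨f, hf⟩ := S.exists_factor (F - ∑ j, S.jumpAt F j • S.h j) fun i => by
    have h1 := S.jumpAt_comp_add 0 (S.jumpAt F) i
    have h2 : (0 : C(X, ℂ)).comp q = 0 := rfl
    rw [h2, zero_add, jumpAt, jumpAt] at h1
    rw [ContinuousMap.sub_apply, ContinuousMap.sub_apply]
    linear_combination -h1
  exact ⟨f, by rw [hf, sub_add_cancel]⟩

variable {A : Type*} [Ring A] [Algebra ℂ A]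

theorem linearMap_ext {T₁ T₂ : C(Y, ℂ) →ₗ[ℂ] A} (h1 : ∀ f : C(X, ℂ), T₁ (f.comp q) = T₂ (f.comp q))
    (h2 : ∀ j, T₁ (S.h j) = T₂ (S.h j)) : T₁ = T₂ := by
  refine LinearMap.ext fun F => ?_
  obtain ⟨f, hf⟩ := S.exists_decomposition F
  rw [hf]
  simp only [map_add, map_sum, map_smul, h1, h2]

/-- The linear extension of `φ` that sends the functions `h j` to prescribed elements. -/
theorem exists_linear_extension (φ : C(X, ℂ) →ₗ[ℂ] A) (H : J → A) :
    ∃ ψ : C(Y, ℂ) →ₗ[ℂ] A, (∀ f : C(X, ℂ), ψ (f.comp q) = φ f) ∧ ∀ j, ψ (S.h j) = H j := by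
  classical
  choose d hd using S.exists_decomposition
  have hzero (F : C(Y, ℂ)) : (0 : ℂ) • F = 0 := zero_smul ℂ F
  have hadd (a b : ℂ) (F : C(Y, ℂ)) : (a + b) • F = a • F + b • F := add_smul a b F
  have hsmul (a b : ℂ) (F : C(Y, ℂ)) : (a * b) • F = a • b • F := mul_smul a b F
  have hsmul_add (a : ℂ) (F G : C(Y, ℂ)) : a • (F + G) = a • F + a • G := smul_add a F G
  have hsmul_sum (a : ℂ) (F : J → C(Y, ℂ)) : a • ∑ j, F j = ∑ j, a • F j := Finset.smul_sum
  have hform : ∀ (f : C(X, ℂ)) (c : J → ℂ) (F : C(Y, ℂ)), F = f.comp q + ∑ j, c j • S.h j →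
      d F = f ∧ S.jumpAt F = c := by
    intro f c F hF
    have h1 : S.jumpAt F = c := by
      funext j
      rw [hF, S.jumpAt_comp_add]
    refine ⟨S.comp_injective ?_, h1⟩
    have h2 := hd F
    rw [h1] at h2
    exact add_right_cancel (h2.symm.trans hF)
  have hcomp : ∀ f : C(X, ℂ), d (f.comp q) = f ∧ S.jumpAt (f.comp q) = 0 := fun f =>
    hform f 0 _ (by simp [hzero])
  have hh : ∀ j, d (S.h j) = 0 ∧ S.jumpAt (S.h j) = Pi.single j 1 := fun j =>
    hform 0 (Pi.single j 1) _ (by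
      have h2 : (0 : C(X, ℂ)).comp q = 0 := rfl
      rw [h2, zero_add, Finset.sum_eq_single j]
      · simp
      · intro i _ hij
        rw [Pi.single_eq_of_ne hij, hzero]
      · simp)
  refine ⟨{ toFun := fun F => φ (d F) + ∑ j, S.jumpAt F j • H j, map_add' := ?_, map_smul' := ?_ },
    ?_, ?_⟩
  · intro F G
    obtain ⟨h1, h2⟩ := hform (d F + d G) (S.jumpAt F + S.jumpAt G) (F + G) (by
      have h3 : (d F + d G).comp q = (d F).comp q + (d G).comp q := rfl
      rw [h3]
      nth_rewrite 1 [hd F, hd G]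
      simp only [Pi.add_apply, hadd, Finset.sum_add_distrib]
      abel)
    rw [h1, h2]
    simp only [map_add, Pi.add_apply, add_smul, Finset.sum_add_distrib]
    abel
  · intro c F
    obtain ⟨h1, h2⟩ := hform (c • d F) (c • S.jumpAt F) (c • F) (by
      have h3 : (c • d F).comp q = c • (d F).comp q := rfl
      rw [h3]
      nth_rewrite 1 [hd F]
      simp only [Pi.smul_apply, smul_eq_mul, hsmul, hsmul_add, hsmul_sum])
    rw [h1, h2]
    simp only [map_smul, Pi.smul_apply, smul_add, Finset.smul_sum, smul_assoc, RingHom.id_apply]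
  · intro f
    simp [hcomp f]
  · intro j
    change φ (d (S.h j)) + ∑ i, S.jumpAt (S.h j) i • H i = H j
    rw [(hh j).1, (hh j).2, map_zero, zero_add, Finset.sum_eq_single j]
    · simp
    · intro i _ hij
      rw [Pi.single_eq_of_ne hij, zero_smul]
    · simp

/-- A `*`-homomorphism extends from `C(X)` to `C(Y)` as soon as there are elements `H j` that
satisfy the relations by which the functions `h j` generate `C(Y)` over `C(X)`. -/
theorem exists_starHom_extension [StarRing A] [StarModule ℂ A] (φ : C(X, ℂ) →⋆ₙₐ[ℂ] A) (H : J → A)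
    (hstar : ∀ j, star (H j) = H j)
    (hsq : ∀ j (m : C(X, ℂ)), m.comp q = S.h j * S.h j - S.h j → H j * H j = H j + φ m)
    (hmul : ∀ j (f g : C(X, ℂ)), g.comp q = f.comp q * S.h j - f (S.pt j) • S.h j →
      φ f * H j = f (S.pt j) • H j + φ g ∧ H j * φ f = f (S.pt j) • H j + φ g) :
    ∃ ψ : C(Y, ℂ) →⋆ₙₐ[ℂ] A, (∀ f : C(X, ℂ), ψ (f.comp q) = φ f) ∧ ∀ j, ψ (S.h j) = H j := by
  obtain ⟨ψ, hψ, hψh⟩ := S.exists_linear_extension (φ : C(X, ℂ) →ₗ[ℂ] A) H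
  replace hψ : ∀ f : C(X, ℂ), ψ (f.comp q) = φ f := hψ
  have hk : ∀ j, φ (S.k j) * H j = H j ∧ H j * φ (S.k j) = H j := by
    intro j
    have h1 := hmul j (S.k j) 0 (by
      rw [S.k_pt, one_smul, S.k_mul_h, sub_self]
      rfl)
    simpa [S.k_pt] using h1
  have horth : ∀ i j, i ≠ j → H i * H j = 0 := by
    intro i j hij
    rw [← (hk i).2, ← (hk j).1, mul_assoc, ← mul_assoc (φ (S.k i)), ← map_mul, S.k_mul_k i j hij,
      map_zero, zero_mul, mul_zero]
  have hψ1 : ∀ (f g : C(X, ℂ)), ψ (f.comp q * g.comp q) = φ f * φ g := fun f g => by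
    have h1 : f.comp q * g.comp q = (f * g).comp q := rfl
    rw [h1, hψ, map_mul]
  have hψ2 : ∀ (f : C(X, ℂ)) j, ψ (f.comp q * S.h j) = φ f * H j ∧
      ψ (f.comp q * S.h j) = H j * φ f := fun f j => by
    obtain ⟨g, hg⟩ := S.exists_comp_eq_mul_sub j f
    rw [(hmul j f g hg).1, (hmul j f g hg).2, sub_eq_iff_eq_add.1 hg.symm, map_add, hψ, map_smul,
      hψh, add_comm]
    exact ⟨rfl, rfl⟩
  have hψ3 : ∀ i j, ψ (S.h i * S.h j) = H i * H j := by
    intro i j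
    by_cases hij : i = j
    · subst hij
      obtain ⟨m, hm⟩ := S.exists_comp_eq_sq_sub i
      rw [hsq i m hm, sub_eq_iff_eq_add.1 hm.symm, map_add, hψ, hψh, add_comm]
    · rw [S.h_mul_h hij, horth i j hij, map_zero]
  have hcomp : ∀ (f : C(X, ℂ)) G, ψ (f.comp q * G) = φ f * ψ G := by
    intro f G
    have h1 : ψ ∘ₗ LinearMap.mulLeft ℂ (f.comp q) = LinearMap.mulLeft ℂ (φ f) ∘ₗ ψ := by
      refine S.linearMap_ext (fun g => ?_) fun j => ?_
      · change ψ (f.comp q * g.comp q) = φ f * ψ (g.comp q)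
        rw [hψ1, hψ]
      · change ψ (f.comp q * S.h j) = φ f * ψ (S.h j)
        rw [(hψ2 f j).1, hψh]
    exact LinearMap.congr_fun h1 G
  have hh : ∀ i G, ψ (S.h i * G) = H i * ψ G := by
    intro i G
    have h1 : ψ ∘ₗ LinearMap.mulLeft ℂ (S.h i) = LinearMap.mulLeft ℂ (H i) ∘ₗ ψ := by
      refine S.linearMap_ext (fun g => ?_) fun j => ?_
      · change ψ (S.h i * g.comp q) = H i * ψ (g.comp q)
        rw [mul_comm, (hψ2 g i).2, hψ]
      · change ψ (S.h i * S.h j) = H i * ψ (S.h j)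
        rw [hψ3, hψh]
    exact LinearMap.congr_fun h1 G
  have hψmul : ∀ F G, ψ (F * G) = ψ F * ψ G := by
    intro F G
    have h1 : ψ ∘ₗ LinearMap.mulRight ℂ G = LinearMap.mulRight ℂ (ψ G) ∘ₗ ψ := by
      refine S.linearMap_ext (fun f => ?_) fun j => ?_
      · change ψ (f.comp q * G) = ψ (f.comp q) * ψ G
        rw [hcomp, hψ]
      · change ψ (S.h j * G) = ψ (S.h j) * ψ G
        rw [hh, hψh]
    exact LinearMap.congr_fun h1 F
  have hψstar : ∀ F, ψ (star F) = star (ψ F) := by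
    intro F
    obtain ⟨f, hf⟩ := S.exists_decomposition F
    have h1 : star (f.comp q) = (star f).comp q := rfl
    rw [hf]
    simp only [star_add, star_sum, star_smul, h1, map_add, map_sum, map_smul, hψ, hψh, S.star_h,
      hstar, map_star]
  exact ⟨{ toFun := ψ, map_smul' := ψ.map_smul, map_zero' := map_zero ψ, map_add' := map_add ψ,
           map_mul' := hψmul, map_star' := hψstar }, hψ, hψh⟩

end JumpSystem

end Extension

/-! ### Extending a homomorphism over the gaps -/

section GapSystem

variable {X : Type*} [TopologicalSpace X] {P : Set X}

/-- The cut-off function that is `1` where `Re θ ≥ 0`, in particular on the support of `jump ∘ θ`,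
and `0` where `θ = -1`. -/
def arcCutoff (θ : C(X, ℂ)) : C(X, ℂ) := ⟨fun x => ((min 1 (1 + (θ x).re) : ℝ) : ℂ), by fun_prop⟩

theorem arcCutoff_apply (θ : C(X, ℂ)) (x : X) :
    arcCutoff θ x = ((min 1 (1 + (θ x).re) : ℝ) : ℂ) := rfl

theorem arcCutoff_eq_one {θ : C(X, ℂ)} {x : X} (h : 0 ≤ (θ x).re) : arcCutoff θ x = 1 := by
  rw [arcCutoff_apply, min_eq_left (by linarith), Complex.ofReal_one]

theorem arcCutoff_eq_zero {θ : C(X, ℂ)} {x : X} (h : θ x = -1) : arcCutoff θ x = 0 := by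
  rw [arcCutoff_apply, h]
  simp

theorem arcCutoff_mul_jump (θ : C(X, ℂ)) (x : X) : arcCutoff θ x * jump (θ x) = jump (θ x) := by
  rcases le_total 0 (θ x).re with h | h
  · rw [arcCutoff_eq_one h, one_mul]
  · rw [jump_of_re_nonpos h, mul_zero]

variable [CWComplex (univ : Set X)]

theorem arcCutoff_mul_gapJump {θ : C(X, ℂ)} {p : X} (hp : θ p = 1) (z : GapSpace P) :
    arcCutoff θ (collapse P z) * gapJump P θ p z = gapJump P θ p z := by
  obtain ⟨y, hy, rfl⟩ | ⟨q, b, rfl⟩ := z.cases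
  · exact arcCutoff_mul_jump θ y
  · rw [collapse_endpoint]
    by_cases h : (q : X) = p
    · rw [h, arcCutoff_eq_one (by rw [hp]; exact zero_le_one), one_mul]
    · rw [gapJump_endpoint_of_ne θ b h, arcCutoff_mul_jump]

/-- Since `jump` is `0` at the point `1`, the function `jump ∘ θ` on `X` is the restriction of
`gapJump` along a (discontinuous) section of `collapse`. -/
theorem exists_collapse_eq_and_gapJump_eq {θ : C(X, ℂ)} {p : X} (hp : θ p = 1) (x : X) :
    ∃ z : GapSpace P, collapse P z = x ∧ gapJump P θ p z = jump (θ x) := by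
  by_cases hx : x ∈ P
  · refine ⟨GapSpace.endpoint ⟨x, hx⟩ false, rfl, ?_⟩
    by_cases h : x = p
    · subst h
      rw [gapJump_endpoint_self θ ⟨x, hx⟩, hp, jump_of_im_nonpos (by simp)]
      rfl
    · exact gapJump_endpoint_of_ne θ false h
  · exact ⟨GapSpace.old x hx, rfl, gapJump_old θ p hx⟩

/-- The data for opening gaps at `x i` and `y i = τ (x i)`: functions `θ i` wrapping small arcs
through `x i` around the circle, such that all of these arcs and their images under `τ` are
disjoint. -/
theorem exists_arcFunctions [T2Space X]
    (hdim : ∀ m : ℕ, 2 ≤ m → IsEmpty (RelCWComplex.cell (univ : Set X) m))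
    (τ : X ≃ₜ X) {n : ℕ} {x y : Fin n → X} (hdist : Function.Injective (Sum.elim x y))
    (hx : ∀ i, ∃ e : RelCWComplex.cell (univ : Set X) 1, x i ∈ RelCWComplex.openCell 1 e)
    (hxy : ∀ i, τ (x i) = y i) :
    ∃ (W : Fin n ⊕ Fin n → Set X) (θ : Fin n → C(X, ℂ)), Pairwise (Function.onFun Disjoint W) ∧
      ∀ i, IsArcFunction (x i) (W (.inl i) ∩ τ ⁻¹' W (.inr i)) (θ i) := by
  obtain ⟨U, hU, hUd⟩ := (Set.finite_range (Sum.elim x y)).t2_separation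
  have h : ∀ i, ∃ θ : C(X, ℂ), IsArcFunction (x i) (U (x i) ∩ τ ⁻¹' U (y i)) θ := by
    intro i
    obtain ⟨e, he⟩ := hx i
    refine exists_isArcFunction hdim he (((hU _).2.inter ((hU _).2.preimage τ.continuous)).mem_nhds
      ⟨(hU _).1, ?_⟩)
    rw [mem_preimage, hxy]
    exact (hU _).1
  choose θ hθ using h
  refine ⟨fun j => U (Sum.elim x y j), θ, fun i j hij => ?_, hθ⟩
  exact hUd ⟨i, rfl⟩ ⟨j, rfl⟩ (hdist.ne hij)

variable [T2Space X]

/-- The gapped space as a system of jumps. The jump functions at the points `y i` are the images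
under `σ` of the jump functions at the points `x i`. -/
theorem exists_jumpSystem [CompactSpace (GapSpace P)] (hP : P.Finite)
    {τ : X ≃ₜ X} (hτ : Function.Involutive τ)
    {σ : GapSpace P ≃ₜ GapSpace P} (hσ : Function.Involutive σ)
    (hστ : ∀ z, collapse P (σ z) = τ (collapse P z))
    {n : ℕ} {x y : Fin n → X} (hxP : ∀ i, x i ∈ P) (hPxy : P ⊆ range x ∪ range y)
    (hxy : ∀ i, τ (x i) = y i) {W : Fin n ⊕ Fin n → Set X} (hW : Pairwise (Function.onFun Disjoint W))
    {θ : Fin n → C(X, ℂ)}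
    (hθ : ∀ i, IsArcFunction (x i) (W (.inl i) ∩ τ ⁻¹' W (.inr i)) (θ i)) :
    ∃ S : JumpSystem (collapse P) (Fin n ⊕ Fin n), (∀ i, S.pt (.inl i) = x i) ∧
      (∀ i, S.pt (.inr i) = y i) ∧ (∀ i z, S.h (.inl i) z = gapJump P (θ i) (x i) z) ∧
      ∀ i z, S.h (.inr i) z = gapJump P (θ i) (x i) (σ z) := by
  have hθ1 : ∀ i, θ i (x i) = 1 := fun i => ((hθ i).eq_one_iff _).2 rfl
  let h0 : Fin n → C(GapSpace P, ℂ) := fun i =>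
    ⟨gapJump P (θ i) (x i), continuous_gapJump hP (p := ⟨x i, hxP i⟩) (hθ i)⟩
  have hk0 : ∀ i v, v ∉ W (.inl i) ∩ τ ⁻¹' W (.inr i) → arcCutoff (θ i) v = 0 := fun i v hv =>
    arcCutoff_eq_zero ((hθ i).eq_neg_one v hv)
  have hfib : ∀ (z : GapSpace P) (p : P), collapse P z = p → ∃ b, z = GapSpace.endpoint p b := by
    intro z p hz
    obtain ⟨v, hv, rfl⟩ | ⟨p', b, rfl⟩ := z.cases
    · rw [collapse_old] at hz
      exact absurd (hz ▸ p.2) hv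
    · exact ⟨b, by rw [show p' = p from Subtype.ext hz]⟩
  refine ⟨{
    pt := Sum.elim x y
    z := Sum.elim (fun i b => GapSpace.endpoint ⟨x i, hxP i⟩ b)
      (fun i b => σ (GapSpace.endpoint ⟨x i, hxP i⟩ b))
    h := Sum.elim h0 (fun i => (h0 i).comp (σ : C(GapSpace P, GapSpace P)))
    k := Sum.elim (fun i => arcCutoff (θ i)) (fun i => (arcCutoff (θ i)).comp (τ : C(X, X)))
    surjective := collapse_surjective
    q_z := ?_
    exists_factor := ?_
    h_true := ?_
    h_false := ?_
    star_h := ?_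
    k_pt := ?_
    k_mul_h := ?_
    k_mul_k := ?_ }, fun _ => rfl, fun _ => rfl, fun _ _ => rfl, fun _ _ => rfl⟩
  · rintro (i | i) b
    · rfl
    · change collapse P (σ _) = y i
      rw [hστ, ← hxy]
      rfl
  · intro F hF
    have hfac : Function.FactorsThrough F (collapse P) := by
      have hends : ∀ i b b', F (GapSpace.endpoint ⟨x i, hxP i⟩ b)
          = F (GapSpace.endpoint ⟨x i, hxP i⟩ b') := by
        intro i b b'
        have h1 : F (GapSpace.endpoint ⟨x i, hxP i⟩ true)
          = F (GapSpace.endpoint ⟨x i, hxP i⟩ false) := hF (.inl i)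
        cases b <;> cases b' <;> simp [h1]
      have hends' : ∀ i b b', F (σ (GapSpace.endpoint ⟨x i, hxP i⟩ b))
          = F (σ (GapSpace.endpoint ⟨x i, hxP i⟩ b')) := by
        intro i b b'
        have h1 : F (σ (GapSpace.endpoint ⟨x i, hxP i⟩ true))
          = F (σ (GapSpace.endpoint ⟨x i, hxP i⟩ false)) := hF (.inr i)
        cases b <;> cases b' <;> simp [h1]
      intro z z' hzz
      by_cases hz : collapse P z ∈ P
      · rcases hPxy hz with ⟨i, hi⟩ | ⟨i, hi⟩
        · obtain ⟨b, rfl⟩ := hfib z ⟨x i, hxP i⟩ hi.symm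
          obtain ⟨b', rfl⟩ := hfib z' ⟨x i, hxP i⟩ (hzz ▸ hi.symm)
          exact hends i b b'
        · have h1 : ∀ z, y i = collapse P z → collapse P (σ z) = x i := fun z h => by
            rw [hστ, ← h, ← hxy, hτ]
          obtain ⟨b, hb⟩ := hfib (σ z) ⟨x i, hxP i⟩ (h1 z hi)
          obtain ⟨b', hb'⟩ := hfib (σ z') ⟨x i, hxP i⟩ (h1 z' (hi.trans hzz))
          rw [← hσ z, ← hσ z', hb, hb']
          exact hends' i b b'
      · obtain ⟨v, hv, rfl⟩ | ⟨p, b, rfl⟩ := z.cases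
        · obtain ⟨v', hv', rfl⟩ | ⟨p', b', rfl⟩ := z'.cases
          · rw [collapse_old, collapse_old] at hzz
            subst hzz
            rfl
          · rw [hzz] at hz
            exact absurd p'.2 hz
        · exact absurd p.2 hz
    have hquot := Topology.IsQuotientMap.of_surjective_continuous (collapse_surjective (P := P))
      (collapse P).continuous
    exact ⟨hquot.lift F hfac, hquot.lift_comp F hfac⟩
  · have h1 : ∀ i, gapJump P (θ i) (x i) (GapSpace.endpoint ⟨x i, hxP i⟩ true) = 1 := fun i => by
      rw [gapJump_endpoint_self (θ i) ⟨x i, hxP i⟩]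
      rfl
    rintro (i | i)
    · exact h1 i
    · change gapJump P (θ i) (x i) (σ (σ _)) = 1
      rw [hσ, h1]
  · have h1 : ∀ i, gapJump P (θ i) (x i) (GapSpace.endpoint ⟨x i, hxP i⟩ false) = 0 := fun i => by
      rw [gapJump_endpoint_self (θ i) ⟨x i, hxP i⟩]
      rfl
    rintro (i | i)
    · exact h1 i
    · change gapJump P (θ i) (x i) (σ (σ _)) = 0
      rw [hσ, h1]
  · rintro (i | i)
    · ext z
      exact star_gapJump _ _ _
    · ext z
      exact star_gapJump _ _ _
  · have h1 : ∀ i, arcCutoff (θ i) (x i) = 1 := fun i =>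
      arcCutoff_eq_one (by rw [hθ1]; exact zero_le_one)
    rintro (i | i)
    · exact h1 i
    · change arcCutoff (θ i) (τ (y i)) = 1
      rw [← hxy, hτ, h1]
  · rintro (i | i)
    · ext z
      exact arcCutoff_mul_gapJump (hθ1 i) z
    · ext z
      change arcCutoff (θ i) (τ (collapse P z)) * gapJump P (θ i) (x i) (σ z)
        = gapJump P (θ i) (x i) (σ z)
      rw [← hστ]
      exact arcCutoff_mul_gapJump (hθ1 i) (σ z)
  · -- the function with index `j` is supported in `W j`
    have hsupp : ∀ (j : Fin n ⊕ Fin n) (v : X), v ∉ W j →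
        (Sum.elim (fun i => arcCutoff (θ i)) (fun i => (arcCutoff (θ i)).comp (τ : C(X, X))) j :
          C(X, ℂ)) v = 0 := by
      rintro (i | i) v hv
      · exact hk0 i v fun h => hv h.1
      · refine hk0 i (τ v) fun h => hv ?_
        have h1 : τ (τ v) ∈ W (.inr i) := h.2
        rwa [hτ] at h1
    intro i j hij
    ext v
    rw [ContinuousMap.mul_apply]
    by_cases hv : v ∈ W i
    · rw [hsupp j v fun h => Set.disjoint_left.1 (hW hij) hv h, mul_zero]
      rfl
    · rw [hsupp i v hv, zero_mul]
      rfl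

/-- The extension of a `*`-`τ`-homomorphism over the gaps. The element of the corona for the gap
at `x i` is constructed first, and its image under the reflection of the corona is then used for
the gap at `y i`; as the points `x i` and `y i` are distinct, this does not lead to a conflict. -/
theorem exists_gap_extension {ι : ℕ → Type} [∀ k, Fintype (ι k)] [∀ k, DecidableEq (ι k)]
    (τM : ∀ k, Reflection (Matrix (ι k) (ι k) ℂ)) [CompactSpace X] [CompactSpace (GapSpace P)]
    (hdim : ∀ m : ℕ, 2 ≤ m → IsEmpty (RelCWComplex.cell (univ : Set X) m)) (hP : P.Finite)
    {τ : X ≃ₜ X} (hτ : Function.Involutive τ)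
    {σ : GapSpace P ≃ₜ GapSpace P} (hσ : Function.Involutive σ)
    (hστ : ∀ z, collapse P (σ z) = τ (collapse P z))
    {n : ℕ} {x y : Fin n → X} (hdist : Function.Injective (Sum.elim x y))
    (hx : ∀ i, ∃ e : RelCWComplex.cell (univ : Set X) 1, x i ∈ RelCWComplex.openCell 1 e)
    (hxP : ∀ i, x i ∈ P) (hPxy : P ⊆ range x ∪ range y) (hxy : ∀ i, τ (x i) = y i)
    (φ : C(X, ℂ) →⋆ₙₐ[ℂ] matCorona ι)
    (hφ : IsTauHom (functionReflection τ hτ) (coronaReflection τM) φ) :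
    ∃ ψ : C(GapSpace P, ℂ) →⋆ₙₐ[ℂ] matCorona ι,
      IsTauHom (functionReflection σ hσ) (coronaReflection τM) ψ ∧
      ψ.comp (collapseHom P) = φ := by
  obtain ⟨W, θ, hW, hθ⟩ := exists_arcFunctions hdim τ hdist hx hxy
  obtain ⟨S, hptx, hpty, hhx, hhy⟩ := exists_jumpSystem hP hτ hσ hστ hxP hPxy hxy hW hθ
  set ρ := coronaReflection τM with hρ
  have hθ1 : ∀ i, θ i (x i) = 1 := fun i => ((hθ i).eq_one_iff _).2 rfl
  choose H hHstar hHsq hHmul using fun i =>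
    exists_jump_element φ (θ i) (hθ i).norm_eq_one (x i) fun v => ((hθ i).eq_one_iff v).1
  have hφρ : ∀ f : C(X, ℂ), ρ (φ (f.comp (τ : C(X, X)))) = φ f := by
    intro f
    have h1 : φ (f.comp (τ : C(X, X))) = ρ (φ f) := hφ f
    rw [h1]
    exact ρ.involutive _
  have hσσ : (σ : C(GapSpace P, GapSpace P)).comp (σ : C(GapSpace P, GapSpace P))
      = ContinuousMap.id _ := by
    ext z
    exact hσ z
  have hqτ : ∀ f : C(X, ℂ), (f.comp (τ : C(X, X))).comp (collapse P)
      = (f.comp (collapse P)).comp (σ : C(GapSpace P, GapSpace P)) := by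
    intro f
    ext z
    exact congrArg f (hστ z).symm
  have hhσ : ∀ i, (S.h (.inr i)).comp (σ : C(GapSpace P, GapSpace P)) = S.h (.inl i) := by
    intro i
    ext z
    change S.h (.inr i) (σ z) = _
    rw [hhy, hhx, hσ]
  have hhσ' : ∀ i, (S.h (.inl i)).comp (σ : C(GapSpace P, GapSpace P)) = S.h (.inr i) := by
    intro i
    rw [← hhσ, ContinuousMap.comp_assoc, hσσ, ContinuousMap.comp_id]
  -- the relations for the elements `H i`
  have hsq : ∀ i (m : C(X, ℂ)),
      m.comp (collapse P) = S.h (.inl i) * S.h (.inl i) - S.h (.inl i) →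
      H i * H i = H i + φ m := by
    intro i m hm
    refine hHsq i m fun v => ?_
    obtain ⟨z, rfl, hz⟩ := exists_collapse_eq_and_gapJump_eq (P := P) (hθ1 i) v
    rw [← hz, ← hhx]
    exact DFunLike.congr_fun hm z
  have hmul : ∀ i (f g : C(X, ℂ)),
      g.comp (collapse P) = f.comp (collapse P) * S.h (.inl i) - f (x i) • S.h (.inl i) →
      φ f * H i = f (x i) • H i + φ g ∧ H i * φ f = f (x i) • H i + φ g := by
    intro i f g hg
    refine hHmul i f g fun v => ?_
    obtain ⟨z, rfl, hz⟩ := exists_collapse_eq_and_gapJump_eq (P := P) (hθ1 i) v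
    rw [← hz, ← hhx, sub_mul]
    exact DFunLike.congr_fun hg z
  obtain ⟨ψ, hψ, hψh⟩ := S.exists_starHom_extension φ (Sum.elim H fun i => ρ (H i)) (by
      rintro (i | i)
      · exact hHstar i
      · change star (ρ (H i)) = ρ (H i)
        rw [← ρ.map_star, hHstar]) (by
      rintro (i | i) m hm
      · exact hsq i m hm
      · have h1 := hsq i (m.comp (τ : C(X, X))) (by
          rw [hqτ, hm, ← hhσ]
          rfl)
        have h2 := congrArg ρ h1
        rw [ρ.map_mul, map_add, hφρ] at h2
        exact h2) (by
      rintro (i | i) f g hg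
      · rw [hptx] at hg ⊢
        exact hmul i f g hg
      · have h0 : (f.comp (τ : C(X, X))) (x i) = f (y i) := congrArg f (hxy i)
        have h1 := hmul i (f.comp (τ : C(X, X))) (g.comp (τ : C(X, X))) (by
          rw [hqτ, hqτ, hg, h0, hpty, ← hhσ]
          rfl)
        have h2 := congrArg ρ h1.1
        have h3 := congrArg ρ h1.2
        rw [ρ.map_mul, map_add, map_smul, hφρ, hφρ, h0] at h2 h3
        rw [hpty]
        exact ⟨h3, h2⟩)
  refine ⟨ψ, fun F => ?_, ?_⟩
  · let σL : C(GapSpace P, ℂ) →ₗ[ℂ] C(GapSpace P, ℂ) := (functionReflection σ hσ).toLinearMap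
    have h1 : (ψ : C(GapSpace P, ℂ) →ₗ[ℂ] matCorona ι) ∘ₗ σL
        = ρ.toLinearMap ∘ₗ (ψ : C(GapSpace P, ℂ) →ₗ[ℂ] matCorona ι) := by
      refine S.linearMap_ext (fun f => ?_) ?_
      · change ψ ((f.comp (collapse P)).comp (σ : C(GapSpace P, GapSpace P)))
          = ρ (ψ (f.comp (collapse P)))
        rw [← hqτ, hψ, hψ]
        exact hφ f
      · rintro (i | i)
        · change ψ ((S.h (.inl i)).comp (σ : C(GapSpace P, GapSpace P))) = ρ (ψ (S.h (.inl i)))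
          rw [hhσ', hψh, hψh]
          rfl
        · change ψ ((S.h (.inr i)).comp (σ : C(GapSpace P, GapSpace P))) = ρ (ψ (S.h (.inr i)))
          rw [hhσ, hψh, hψh]
          exact (ρ.involutive (H i)).symm
    exact LinearMap.congr_fun h1 F
  · ext f
    exact hψ f

end GapSystem

end TauAlg

end

theorem mainTheorem6 {X : Type*} [TopologicalSpace X] [T2Space X] [CompactSpace X]
    [Topology.CWComplex (Set.univ : Set X)]
    (hdim : ∀ m : ℕ, 2 ≤ m → IsEmpty (Topology.RelCWComplex.cell (Set.univ : Set X) m))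
    (τ : X ≃ₜ X) (hτ : Function.Involutive τ)
    (n : ℕ) (x y : Fin n → X) (hdist : Function.Injective (Sum.elim x y))
    (hx : ∀ i, ∃ e : Topology.RelCWComplex.cell (Set.univ : Set X) 1,
      x i ∈ Topology.RelCWComplex.openCell 1 e)
    (hy : ∀ i, ∃ e : Topology.RelCWComplex.cell (Set.univ : Set X) 1,
      y i ∈ Topology.RelCWComplex.openCell 1 e)
    (hxy : ∀ i, τ (x i) = y i)
    (P : Set X) (hP : P = Set.range x ∪ Set.range y) :
    CompactSpace (TauAlg.GapSpace P) ∧ T2Space (TauAlg.GapSpace P) ∧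
    ∃ (σ : TauAlg.GapSpace P ≃ₜ TauAlg.GapSpace P) (hσ : Function.Involutive σ),
      -- `σ` is the reflection defined by `τ`
      (∀ z, TauAlg.collapse P (σ z) = τ (TauAlg.collapse P z)) ∧
      (∀ σ' : TauAlg.GapSpace P ≃ₜ TauAlg.GapSpace P,
        (∀ z, TauAlg.collapse P (σ' z) = τ (TauAlg.collapse P z)) → σ' = σ) ∧
      -- the gap-collapsing map is a `*`-`τ`-homomorphism
      TauAlg.IsTauHom (TauAlg.functionReflection τ hτ) (TauAlg.functionReflection σ hσ)
        (TauAlg.collapseHom P) ∧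
      -- extension for the transpose
      (∀ (d : ℕ → ℕ) (φ : C(X, ℂ) →⋆ₙₐ[ℂ] TauAlg.matCorona (fun k => Fin (d k))),
        TauAlg.IsTauHom (TauAlg.functionReflection τ hτ)
          (TauAlg.coronaReflection fun k => TauAlg.transposeReflection (Fin (d k))) φ →
        ∃ ψ : C(TauAlg.GapSpace P, ℂ) →⋆ₙₐ[ℂ] TauAlg.matCorona (fun k => Fin (d k)),
          TauAlg.IsTauHom (TauAlg.functionReflection σ hσ)
            (TauAlg.coronaReflection fun k => TauAlg.transposeReflection (Fin (d k))) ψ ∧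
          ψ.comp (TauAlg.collapseHom P) = φ) ∧
      -- extension for the dual operation, on matrices of even size `d k = 2 * m k`
      (∀ (m : ℕ → ℕ) (φ : C(X, ℂ) →⋆ₙₐ[ℂ] TauAlg.matCorona (fun k => Fin (m k) ⊕ Fin (m k))),
        TauAlg.IsTauHom (TauAlg.functionReflection τ hτ)
          (TauAlg.coronaReflection fun k => TauAlg.sharpReflection (Fin (m k))) φ →
        ∃ ψ : C(TauAlg.GapSpace P, ℂ) →⋆ₙₐ[ℂ] TauAlg.matCorona (fun k => Fin (m k) ⊕ Fin (m k)),
          TauAlg.IsTauHom (TauAlg.functionReflection σ hσ)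
            (TauAlg.coronaReflection fun k => TauAlg.sharpReflection (Fin (m k))) ψ ∧
          ψ.comp (TauAlg.collapseHom P) = φ) := by
  have hPf : P.Finite := hP ▸ (Set.finite_range x).union (Set.finite_range y)
  have hPe : ∀ p ∈ P, ∃ e : Topology.RelCWComplex.cell (Set.univ : Set X) 1,
      p ∈ Topology.RelCWComplex.openCell 1 e := by
    rw [hP]
    rintro p (⟨i, rfl⟩ | ⟨i, rfl⟩)
    · exact hx i
    · exact hy i
  have hxP : ∀ i, x i ∈ P := fun i => hP ▸ Or.inl ⟨i, rfl⟩
  have hτP : ∀ p ∈ P, τ p ∈ P := by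
    rw [hP]
    rintro p (⟨i, rfl⟩ | ⟨i, rfl⟩)
    · exact Or.inr ⟨i, (hxy i).symm⟩
    · exact Or.inl ⟨i, by rw [← hxy, hτ]⟩
  have hcompact := TauAlg.compactSpace_gapSpace hdim hPf hPe
  have hT2 := TauAlg.t2Space_gapSpace hdim hPf hPe
  obtain ⟨σ, hσ, hστ⟩ := TauAlg.exists_gap_reflection hdim hPf hPe τ hτ hτP
  refine ⟨hcompact, hT2, σ, hσ, hστ, fun σ' hσ' => ?_, fun f => ?_, fun d φ hφ => ?_,
    fun m φ hφ => ?_⟩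
  · refine DFunLike.coe_injective (TauAlg.eq_of_collapse_eq hPf hPe (t := τ)
      (fun p hp h => hp (hτ p ▸ hτP _ h)) σ'.continuous σ.continuous hσ' hστ)
  · ext z
    exact congrArg f (hστ z).symm
  · exact TauAlg.exists_gap_extension _ hdim hPf hτ hσ hστ hdist hx hxP hP.subset hxy φ hφ
  · exact TauAlg.exists_gap_extension _ hdim hPf hτ hσ hστ hdist hx hxP hP.subset hxy φ hφ
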